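/- Let $\Sigma$ be a smooth surface with a conformal structure $c$ of signature $(1,1)$ and Hodge star $*$ on $1$-forms ($*^2=1$); null coordinates $(\xi,\eta)$ are labelled so that $*d\xi=d\xi$, $*d\eta=-d\eta$. A smooth map $N:(\Sigma,c)\to S^2\subset\mathbb{R}^3$ is harmonic if the tangential part of $d{*}dN$ vanishes, equivalently $d(N\times *dN)=0$. Identify $\mathbb{R}^3\cong\mathfrak{so}(3)$ and $\mathbb{C}^3\cong\mathfrak{so}(3,\mathbb{C})$ by $v\mapsto(u\mapsto v\times u)$, put $\mathcal N=N\times dN$, $\mathcal D=d-\mathcal N$, $\mathcal N^{\pm}=\tfrac12(\mathcal N\pm *\mathcal N)$ and, for $\lambda\in\mathbb{C}^\times$, $d_\lambda=\mathcal D+\lambda\mathcal N^++\lambda^{-1}\mathcal N^-$, a connection on $\Sigma\times\mathbb{C}^3$. A trivialising gauge of $d_\lambda$ is a smooth $T_\lambda:\Sigma\to \mathrm{SO}(3,\mathbb{C})$ with $T_\lambda\circ d_\lambda=d\circ T_\lambda$. **Theorem.** Let $N:(\Sigma,c)\to S^2$ be harmonic, let $\mu\in\mathbb{R}\setminus\{0\}$,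 let $T_\mu:\Sigma\to\mathrm{SO}(3)$ be a (real) trivialising gauge of $d_\mu$, and put $N^\mu:=T_\mu N$. 1. $N^\mu:(\Sigma,c)\to S^2$ is harmonic. Hence near every point there is a smooth $f^\mu$ with $df^\mu=N^\mu\times *dN^\mu$. On every open set on which such an $f^\mu$ is defined and $N$ is an immersion, $f^\mu$ is an immersion with Gauss map $N^\mu$ and constant Gauss curvature $K=-1$ (a $K$-surface), and its second fundamental form is, at each point, a non-zero multiple of the metrics in $c$. 2. Let $f,f^\mu$ be smooth maps on an open set $V$ with $df=N\times *dN$ and $df^\mu=N^\mu\times *dN^\mu$, and let $(\xi,\eta)$ be null coordinates on an open subset of $V$ that are Tchebyshev for $f$ (asymptotic, with $|f_\xi|=|f_\eta|=1$), so that $I_f=d\xi^2+2\cos\omega\,d\xi d\eta+d\eta^2$. Then $$I_{f^\mu}=\mu^2d\xi^2+2\cos\omega\,d\xi d\eta+\mu^{-2}d\eta^2 .$$ If moreover $N$ is an immersion there and $\omega$ is smooth, then $f^\mu$ is a Lie transform of $f$: $\hat\xi=\mu\xi$, $\hat\eta=\mu^{-1}\eta$ are Tchebyshev coordinates for the $K$-surface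 $f^\mu$ (with $K=-1$), in which $I_{f^\mu}=d\hat\xi^2+2\cos\omega^\mu\,d\hat\xi d\hat\eta+d\hat\eta^2$, where $\omega^\mu(\hat\xi,\hat\eta)=\omega(\mu^{-1}\hat\xi,\mu\hat\eta)$ solves the sine-Gordon equation $\omega^\mu_{\hat\xi\hat\eta}=\sin\omega^\mu$. 3. (Sym formula) Suppose $T_\mu$ is the value at $\lambda=\mu$ of a family of trivialising gauges $T_\lambda$ of $d_\lambda$, for $\lambda\in\mathbb{C}$ near $\mu$, that depends smoothly on $(\lambda,x)$, is holomorphic in $\lambda$ at $\mu$, and is real for real $\lambda$. Then $\mu\,\frac{\partial T_\lambda}{\partial\lambda}\big|_{\lambda=\mu}T_\mu^{-1}$ takes values in $\mathfrak{so}(3)\cong\mathbb{R}^3$ and, as a smooth map $F:\Sigma\to\mathbb{R}^3$, satisfies $dF=N^\mu\times *dN^\mu$; so on every connected open set any $f^\mu$ as in 1 is equal to $F$ up to a translation. -/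

import Mathlib

open scoped Manifold ContDiff Matrix Topology

noncomputable section

namespace KSurf

/-- The model plane, with coordinates `(ξ, η)`. -/
abbrev Plane : Type := ℝ × ℝ

/-- Vectors of `ℝ³`.  Lengths and angles are always expressed through the dot product `⬝ᵥ`
(the norm that Mathlib puts on this type only serves to define smoothness). -/
abbrev R3 : Type := Fin 3 → ℝ

/-- Vectors of `ℂ³`, with the complex bilinear dot and cross products. -/
abbrev C3 : Type := Fin 3 → ℂ

/-- Inclusion `ℝ³ ⊆ ℂ³`. -/
def toC (v : R3) : C3 := fun i => (v i : ℂ)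

section Surfaces

variable {M : Type*} [TopologicalSpace M] [ChartedSpace Plane M]

/-- Matrix (in the coordinates given by the chart `e`) of a field of endomorphisms of the tangent
spaces. -/
def coordEndo (J : ∀ x : M, TangentSpace 𝓘(ℝ, Plane) x →L[ℝ] TangentSpace 𝓘(ℝ, Plane) x)
    (e : OpenPartialHomeomorph M Plane) (y : Plane) : Plane →L[ℝ] Plane :=
  (mfderiv 𝓘(ℝ, Plane) 𝓘(ℝ, Plane) e (e.symm y)).comp
    ((J (e.symm y)).comp (mfderiv 𝓘(ℝ, Plane) 𝓘(ℝ, Plane) e.symm y))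

variable (M) in
/-- A conformal structure of signature `(1,1)` on a surface, given by a smooth representative metric
`g`, together with its Hodge star on 1-forms, written as `*α = α ∘ J`.
For a given conformal class the field `J` is determined up to sign by `J² = 1` and skewness; the
choice of sign is the choice of an orientation. -/
structure LorentzConformalStructure where
  g : ∀ x : M, TangentSpace 𝓘(ℝ, Plane) x →L[ℝ] TangentSpace 𝓘(ℝ, Plane) x →L[ℝ] ℝ
  g_symm : ∀ x X Y, g x X Y = g x Y X
  g_pos : ∀ x, ∃ X, 0 < g x X X
  g_neg : ∀ x, ∃ X, g x X X < 0
  g_smooth : ∀ e ∈ IsManifold.maximalAtlas 𝓘(ℝ, Plane) ∞ M, ∀ v w : Plane,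
    ContDiffOn ℝ ∞ (fun y : Plane => g (e.symm y)
      (mfderiv 𝓘(ℝ, Plane) 𝓘(ℝ, Plane) e.symm y v)
      (mfderiv 𝓘(ℝ, Plane) 𝓘(ℝ, Plane) e.symm y w)) e.target
  J : ∀ x : M, TangentSpace 𝓘(ℝ, Plane) x →L[ℝ] TangentSpace 𝓘(ℝ, Plane) x
  J_sq : ∀ x X, J x (J x X) = X
  J_skew : ∀ x X Y, g x (J x X) Y = -g x X (J x Y)
  J_smooth : ∀ e ∈ IsManifold.maximalAtlas 𝓘(ℝ, Plane) ∞ M, ∀ v : Plane,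
    ContDiffOn ℝ ∞ (fun y => coordEndo J e y v) e.target

/-- The differential of a map `Σ → ℝ³`. -/
def d (f : M → R3) (x : M) : TangentSpace 𝓘(ℝ, Plane) x →L[ℝ] R3 :=
  mfderiv 𝓘(ℝ, Plane) 𝓘(ℝ, R3) f x

/-- The trivial connection on sections of the trivial `ℂ³`-bundle. -/
def dC (σ : M → C3) (x : M) : TangentSpace 𝓘(ℝ, Plane) x →L[ℝ] C3 :=
  mfderiv 𝓘(ℝ, Plane) 𝓘(ℝ, C3) σ x

/-- The component along `dξ ∧ dη` of the `ℝ³`-valued 2-form `d(*dN)`, in the chart `e = (ξ, η)`. -/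
def dStarD (c : LorentzConformalStructure M) (N : M → R3)
    (e : OpenPartialHomeomorph M Plane) (y : Plane) : R3 :=
  fderiv ℝ (fun z => fderiv ℝ (N ∘ e.symm) z (coordEndo c.J e z (0, 1))) y (1, 0)
    - fderiv ℝ (fun z => fderiv ℝ (N ∘ e.symm) z (coordEndo c.J e z (1, 0))) y (0, 1)

/-- `N : (Σ, c) → S²` is a smooth harmonic map: `d(*dN)` has no component tangent to the sphere. -/
structure IsHarmonic (c : LorentzConformalStructure M) (N : M → R3) : Prop where
  smooth : ContMDiff 𝓘(ℝ, Plane) 𝓘(ℝ, R3) ∞ N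
  unit : ∀ x, N x ⬝ᵥ N x = 1
  tension : ∀ e ∈ IsManifold.maximalAtlas 𝓘(ℝ, Plane) ∞ M, ∀ y ∈ e.target,
    N (e.symm y) ⨯₃ dStarD c N e y = 0

/-! ### Immersed surfaces -/

/-- First fundamental form `I = df · df`. -/
def firstForm (f : M → R3) (x : M) (X Y : TangentSpace 𝓘(ℝ, Plane) x) : ℝ :=
  d f x X ⬝ᵥ d f x Y

/-- Second fundamental form `II = -df · dN`. -/
def secondForm (f N : M → R3) (x : M) (X Y : TangentSpace 𝓘(ℝ, Plane) x) : ℝ :=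
  -(d f x X ⬝ᵥ d N x Y)

/-- On `V`, the map `f` is a smooth immersion with Gauss map `N`. -/
structure IsImmersionWithGaussMapOn (V : Set M) (f N : M → R3) : Prop where
  smooth : ContMDiffOn 𝓘(ℝ, Plane) 𝓘(ℝ, R3) ∞ f V
  smooth_gauss : ContMDiffOn 𝓘(ℝ, Plane) 𝓘(ℝ, R3) ∞ N V
  immersion : ∀ x ∈ V, Function.Injective (d f x)
  unit : ∀ x ∈ V, N x ⬝ᵥ N x = 1
  normal : ∀ x ∈ V, ∀ X, N x ⬝ᵥ d f x X = 0

/-- The Gauss curvature of `f` at `x` is `K`: the determinant of the shape operator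
`S = -(df)⁻¹ ∘ dN`, which is unique where `f` is an immersion. -/
def HasGaussCurvatureAt (f N : M → R3) (x : M) (K : ℝ) : Prop :=
  ∃ S : TangentSpace 𝓘(ℝ, Plane) x →ₗ[ℝ] TangentSpace 𝓘(ℝ, Plane) x,
    (∀ X, d f x (S X) = -d N x X) ∧ LinearMap.det S = K

/-- On `V`, `f` is a `K`-surface with Gauss map `N` and constant negative Gauss curvature `K`. -/
structure IsKSurfaceOn (V : Set M) (f N : M → R3) (K : ℝ) : Prop where
  neg : K < 0
  immersed : IsImmersionWithGaussMapOn V f N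
  curvature : ∀ x ∈ V, HasGaussCurvatureAt f N x K

/-- `df = N × *dN` on `V`. -/
structure IsLelieuvreOn (c : LorentzConformalStructure M) (N : M → R3) (V : Set M)
    (f : M → R3) : Prop where
  smooth : ContMDiffOn 𝓘(ℝ, Plane) 𝓘(ℝ, R3) ∞ f V
  eq : ∀ x ∈ V, ∀ X, d f x X = N x ⨯₃ d N x (c.J x X)

/-! ### The family of connections -/

/-- The 1-form `𝒩`, with values in `so(3) ⊆ so(3, ℂ)`, of the splitting `d = 𝒟 + 𝒩` induced by
`ℝ³ = ⟨N⟩ ⊕ N^⊥`; under `v ↦ (u ↦ v × u)` it is `N × dN`. -/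
def calN (N : M → R3) (x : M) (X : TangentSpace 𝓘(ℝ, Plane) x) (u : C3) : C3 :=
  toC (N x ⨯₃ d N x X) ⨯₃ u

/-- `𝒩⁺ = (𝒩 + *𝒩)/2`. -/
def calNPlus (c : LorentzConformalStructure M) (N : M → R3) (x : M)
    (X : TangentSpace 𝓘(ℝ, Plane) x) (u : C3) : C3 :=
  (1 / 2 : ℂ) • (calN N x X u + calN N x (c.J x X) u)

/-- `𝒩⁻ = (𝒩 - *𝒩)/2`. -/
def calNMinus (c : LorentzConformalStructure M) (N : M → R3) (x : M)
    (X : TangentSpace 𝓘(ℝ, Plane) x) (u : C3) : C3 :=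
  (1 / 2 : ℂ) • (calN N x X u - calN N x (c.J x X) u)

/-- The connection `𝒟 = d - 𝒩`, on sections of the trivial `ℂ³`-bundle. -/
def calD (N : M → R3) (σ : M → C3) (x : M) (X : TangentSpace 𝓘(ℝ, Plane) x) : C3 :=
  dC σ x X - calN N x X (σ x)

/-- The connection `d_l = 𝒟 + l 𝒩⁺ + l⁻¹ 𝒩⁻`. -/
def dLam (c : LorentzConformalStructure M) (N : M → R3) (l : ℂ) (σ : M → C3) (x : M)
    (X : TangentSpace 𝓘(ℝ, Plane) x) : C3 :=
  calD N σ x X + l • calNPlus c N x X (σ x) + l⁻¹ • calNMinus c N x X (σ x)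

/-- `T : Σ → SO(3, ℂ)` is a trivialising gauge of `d_l`: `T ∘ d_l = d ∘ T` on sections. -/
structure IsTrivialisingGauge (c : LorentzConformalStructure M) (N : M → R3) (l : ℂ)
    (T : M → Matrix (Fin 3) (Fin 3) ℂ) : Prop where
  smooth : ∀ i j, ContMDiff 𝓘(ℝ, Plane) 𝓘(ℝ, ℂ) ∞ (fun x => T x i j)
  orth : ∀ x, T x * (T x)ᵀ = 1
  det : ∀ x, (T x).det = 1
  gauge : ∀ σ : M → C3, ContMDiff 𝓘(ℝ, Plane) 𝓘(ℝ, C3) ∞ σ → ∀ x X,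
    T x *ᵥ dLam c N l σ x X = dC (fun y => T y *ᵥ σ y) x X

/-- A family `l ↦ T_l` of trivialising gauges of `d_l`, defined for `l` near the real number `μ`,
smooth in all variables, holomorphic in `l` at `μ`, and real for real `l`. -/
structure IsGaugeFamilyNear (c : LorentzConformalStructure M) (N : M → R3) (μ : ℝ)
    (T : ℂ → M → Matrix (Fin 3) (Fin 3) ℂ) : Prop where
  gauge : ∀ᶠ l in 𝓝 (μ : ℂ), IsTrivialisingGauge c N l (T l)
  smooth : ∀ x i j, ContMDiffAt (𝓘(ℝ, ℂ).prod 𝓘(ℝ, Plane)) 𝓘(ℝ, ℂ) ∞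
    (fun p : ℂ × M => T p.1 p.2 i j) ((μ : ℂ), x)
  holo : ∀ x i j, DifferentiableAt ℂ (fun l => T l x i j) (μ : ℂ)
  real : ∀ᶠ s : ℝ in 𝓝 μ, ∀ x i j, (T (s : ℂ) x i j).im = 0

/-- `μ (∂T_l/∂l)|_{l = μ} T_μ⁻¹`. -/
def symMatrix (μ : ℝ) (T : ℂ → M → Matrix (Fin 3) (Fin 3) ℂ) (x : M) :
    Matrix (Fin 3) (Fin 3) ℂ :=
  (μ : ℂ) • (Matrix.of (fun i j => deriv (fun l => T l x i j) (μ : ℂ)) * (T (μ : ℂ) x)⁻¹)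

/-- `e = (ξ, η)` is a chart of null coordinates of `c`, labelled so that `*dξ = dξ`,
`*dη = -dη`. -/
def IsNullChart (c : LorentzConformalStructure M) (e : OpenPartialHomeomorph M Plane) : Prop :=
  e ∈ IsManifold.maximalAtlas 𝓘(ℝ, Plane) ∞ M ∧
    ∀ y ∈ e.target, coordEndo c.J e y (1, 0) = (1, 0) ∧ coordEndo c.J e y (0, 1) = -(0, 1)

end Surfaces

/-! ### Surfaces in coordinates -/

/-- The coordinates of the plane are Tchebyshev on `U` for the surface `f` with Gauss map `N`:
they are asymptotic, with coordinate vectors of unit length. -/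
structure IsTchebyshevOn (U : Set Plane) (f N : Plane → R3) : Prop where
  asymp_fst : ∀ y ∈ U, d N y (1, 0) ⬝ᵥ d f y (1, 0) = 0
  asymp_snd : ∀ y ∈ U, d N y (0, 1) ⬝ᵥ d f y (0, 1) = 0
  unit_fst : ∀ y ∈ U, d f y (1, 0) ⬝ᵥ d f y (1, 0) = 1
  unit_snd : ∀ y ∈ U, d f y (0, 1) ⬝ᵥ d f y (0, 1) = 1

/-- `I_f = A dξ² + 2 cos ω dξ dη + B dη²` on `U`. -/
def HasFirstFormOn (U : Set Plane) (f : Plane → R3) (A : ℝ) (om : Plane → ℝ) (B : ℝ) : Prop :=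
  ∀ y ∈ U, ∀ a b : ℝ,
    firstForm f y (a, b) (a, b) = A * a ^ 2 + 2 * Real.cos (om y) * a * b + B * b ^ 2

/-- The sine-Gordon equation `ω_{ξη} = -K sin ω` on `U` (that is, `ρ⁻² sin ω` for `K = -ρ⁻²`). -/
def SineGordonOn (U : Set Plane) (K : ℝ) (om : Plane → ℝ) : Prop :=
  ContDiffOn ℝ ∞ om U ∧
    ∀ y ∈ U, fderiv ℝ (fun z => fderiv ℝ om z (1, 0)) y (0, 1) = -K * Real.sin (om y)

/-- `(ξ, η) ↦ (μ⁻¹ ξ, μ η)`. -/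
def lieScale (μ : ℝ) (p : Plane) : Plane := (μ⁻¹ * p.1, μ * p.2)

/-- `fμ`, with Gauss map `Nμ`, is a Lie transform, with parameter `μ`, of a surface of curvature `K`
that is parametrised on `U` by Tchebyshev coordinates with angle `ω`: it is a surface of the same
curvature, parametrised by Tchebyshev coordinates on the rescaled domain, whose angle is the
solution `ω^μ(ξ, η) = ω(μ⁻¹ ξ, μ η)` of the sine-Gordon equation. -/
structure IsLieTransform (μ : ℝ) (U : Set Plane) (K : ℝ) (om : Plane → ℝ)
    (fμ Nμ : Plane → R3) : Prop where
  ksurface : IsKSurfaceOn (lieScale μ ⁻¹' U) fμ Nμ K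
  tchebyshev : IsTchebyshevOn (lieScale μ ⁻¹' U) fμ Nμ
  angle : HasFirstFormOn (lieScale μ ⁻¹' U) fμ 1 (om ∘ lieScale μ) 1
  sineGordon : SineGordonOn (lieScale μ ⁻¹' U) K (om ∘ lieScale μ)

end KSurf

end

/-!
Write `B_s` for the endomorphism of tangent vectors that multiplies the `ξ`-direction by `s` and the
`η`-direction by `s⁻¹`. Then `d_λ - d = N × dN ∘ (B_λ - 1)`, and a trivialising gauge satisfies
`dT = T ∘ (N × dN ∘ (B_μ - 1))`, which gives `dN^μ = T (dN ∘ B_μ)`. Since `B_μ` commutes with `*`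
and preserves determinants, and `T` is a rotation, `N^μ × *dN^μ = T ((N × *dN) ∘ B_μ)`, and the
fundamental forms of `f^μ` are those of `f` precomposed with `B_μ`.  Harmonicity persists because
`T⁻¹ dT` maps the vectors tangent to the sphere at `N` to normal ones.

In Tchebyshev coordinates `N` is a net on the sphere with unit tangents `N_ξ`, `N_η` of signed area
`W = N · (N_ξ × N_η)`, so `W² = sin² ω`. If `k` is the geodesic curvature of the `ξ`-lines, then
harmonicity gives `k_η = W` and the angle relation gives `k W = sin ω ω_ξ`; differentiating the
latter in `η` yields the sine-Gordon equation.

The Sym formula is the `λ`-derivative of `dT_λ = T_λ (N × dN ∘ (B_λ - 1))`: since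
`λ ∂B_λ/∂λ = * ∘ B_λ`, commuting the two derivatives gives
`d (λ ∂T_λ/∂λ T_λ⁻¹) = T_λ (N × *dN ∘ B_λ) T_λ⁻¹`.
-/

namespace KSurf

/-! ### Linear algebra -/

section CrossProduct

variable {R ι : Type*} [CommRing R] [Fintype ι] [DecidableEq ι]

theorem transpose_mulVec_cross_mulVec (A : Matrix (Fin 3) (Fin 3) R) (u v : Fin 3 → R) :
    Aᵀ *ᵥ ((A *ᵥ u) ⨯₃ (A *ᵥ v)) = A.det • (u ⨯₃ v) := by
  ext i
  fin_cases i <;>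
    simp [Matrix.mulVec, dotProduct, cross_apply, Fin.sum_univ_three, Matrix.det_fin_three] <;>
    ring

theorem mulVec_cross_mulVec {A : Matrix (Fin 3) (Fin 3) R} (hA : A * Aᵀ = 1) (hdet : A.det = 1)
    (u v : Fin 3 → R) : (A *ᵥ u) ⨯₃ (A *ᵥ v) = A *ᵥ (u ⨯₃ v) := by
  rw [← one_smul R (u ⨯₃ v), ← hdet, ← transpose_mulVec_cross_mulVec, Matrix.mulVec_mulVec, hA,
    Matrix.one_mulVec]

theorem mulVec_dotProduct_mulVec {A : Matrix ι ι R} (hA : A * Aᵀ = 1) (u v : ι → R) :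
    (A *ᵥ u) ⬝ᵥ (A *ᵥ v) = u ⬝ᵥ v := by
  rw [Matrix.dotProduct_mulVec, Matrix.vecMul_mulVec, mul_eq_one_comm.mp hA, Matrix.vecMul_one]

theorem mulVec_injective_of_mul_transpose {A : Matrix ι ι R} (hA : A * Aᵀ = 1) :
    Function.Injective (A *ᵥ ·) :=
  Matrix.mulVec_injective_of_isUnit (.of_mul_eq_one _ hA)

variable {n u v w : Fin 3 → R}

theorem cross_cross_of_dotProduct_eq_zero (hn : n ⬝ᵥ n = 1) (hv : n ⬝ᵥ v = 0) :
    n ⨯₃ (n ⨯₃ v) = -v := by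
  rw [cross_cross_eq_smul_sub_smul', hn, hv, zero_smul, one_smul, zero_sub]

theorem cross_cross_self_of_dotProduct_eq_zero (hn : n ⬝ᵥ n = 1) (hv : n ⬝ᵥ v = 0) :
    (n ⨯₃ v) ⨯₃ n = v := by
  rw [← cross_anticomm, cross_cross_of_dotProduct_eq_zero hn hv, neg_neg]

theorem cross_dotProduct_cross_of_dotProduct_eq_zero (hn : n ⬝ᵥ n = 1) (hv : n ⬝ᵥ v = 0) :
    (n ⨯₃ u) ⬝ᵥ (n ⨯₃ v) = u ⬝ᵥ v := by
  rw [cross_dot_cross, hn, hv, one_mul, zero_mul, sub_zero]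

theorem eq_dotProduct_smul_of_cross_eq_zero (hn : n ⬝ᵥ n = 1) (hv : n ⨯₃ v = 0) :
    v = (n ⬝ᵥ v) • n := by
  have h := cross_cross_eq_smul_sub_smul' n n v
  rw [hv, hn, map_zero, one_smul] at h
  exact (sub_eq_zero.mp h.symm).symm

theorem cross_cross_eq_zero (hv : n ⬝ᵥ v = 0) (hw : n ⬝ᵥ w = 0) : n ⨯₃ (v ⨯₃ w) = 0 := by
  rw [cross_cross_eq_smul_sub_smul', hw, dotProduct_comm v n, hv, zero_smul, zero_smul, sub_zero]

theorem cross_eq_tripleProduct_smul (hn : n ⬝ᵥ n = 1) (hv : n ⬝ᵥ v = 0) (hw : n ⬝ᵥ w = 0) :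
    v ⨯₃ w = (n ⬝ᵥ v ⨯₃ w) • n :=
  eq_dotProduct_smul_of_cross_eq_zero hn (cross_cross_eq_zero hv hw)

theorem crossProduct_injective : Function.Injective (crossProduct : (Fin 3 → R) →ₗ[R] _) := by
  intro v w h
  ext i
  have h₀ := congrArg (· ![1, 0, 0]) h
  have h₁ := congrArg (· ![0, 1, 0]) h
  simp only [cross_apply, Matrix.cons_val, Matrix.vecCons_inj] at h₀ h₁
  fin_cases i <;> simp_all

end CrossProduct

section AlternatingForms

variable {K E F : Type*} [Field K] [AddCommGroup E] [Module K E] [AddCommGroup F] [Module K F]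
  {B : E →ₗ[K] E →ₗ[K] F} {β : E →ₗ[K] E →ₗ[K] K}

theorem apply_eq_det_smul_of_isAlt (b : Module.Basis (Fin 2) K E) (hB : B.IsAlt) (X Y : E) :
    B X Y = b.det ![X, Y] • B (b 0) (b 1) := by
  conv_lhs => rw [← b.sum_repr X, ← b.sum_repr Y]
  simp only [Fin.sum_univ_two, map_add, map_smul, LinearMap.add_apply, LinearMap.smul_apply,
    hB.self_eq_zero, ← hB.neg (b 0) (b 1), b.det_apply, Matrix.det_fin_two,
    Module.Basis.toMatrix_apply, Matrix.cons_val_zero, Matrix.cons_val_one]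
  module

theorem map_comm_of_basis (b : Module.Basis (Fin 2) K E) (h : B (b 0) (b 1) = B (b 1) (b 0))
    (X Y : E) : B X Y = B Y X := by
  have hB : (B - B.flip).IsAlt := fun X => sub_self _
  refine sub_eq_zero.mp ((apply_eq_det_smul_of_isAlt b hB X Y).trans ?_)
  rw [LinearMap.sub_apply, LinearMap.sub_apply, LinearMap.flip_apply, h, sub_self, smul_zero]

theorem apply_map_map_of_isAlt (b : Module.Basis (Fin 2) K E) (hB : B.IsAlt)
    (S : E →ₗ[K] E) (X Y : E) : B (S X) (S Y) = LinearMap.det S • B X Y := by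
  have hdet : b.det ![S X, S Y] = LinearMap.det S * b.det ![X, Y] := by
    rw [← b.det_comp]
    congr 1
    exact (List.ofFn_inj.mp rfl)
  rw [apply_eq_det_smul_of_isAlt b hB, hdet, mul_smul, ← apply_eq_det_smul_of_isAlt b hB]

theorem exists_eq_smul_of_isAlt (b : Module.Basis (Fin 2) K E) (hβ : β.IsAlt) (hβ₀ : β ≠ 0)
    (hB : B.IsAlt) : ∃ w : F, ∀ X Y, B X Y = β X Y • w := by
  have hb : β (b 0) (b 1) ≠ 0 := fun h => hβ₀ <| by
    ext X Y
    rw [apply_eq_det_smul_of_isAlt b hβ, h, smul_zero, LinearMap.zero_apply, LinearMap.zero_apply]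
  refine ⟨(β (b 0) (b 1))⁻¹ • B (b 0) (b 1), fun X Y => ?_⟩
  rw [apply_eq_det_smul_of_isAlt b hβ, smul_eq_mul, smul_smul, mul_assoc, mul_inv_cancel₀ hb,
    mul_one, ← apply_eq_det_smul_of_isAlt b hB]

end AlternatingForms

section SkewInvolution

variable {K E F : Type*} [Field K] [NeZero (2 : K)] [AddCommGroup E] [Module K E]
  [AddCommGroup F] [Module K F] {g : E →ₗ[K] E →ₗ[K] K} {J : E →ₗ[K] E}

theorem isAlt_comp_of_skew (hg : ∀ X Y, g X Y = g Y X) (hJ : ∀ X Y, g (J X) Y = -g X (J Y)) :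
    (g ∘ₗ J).IsAlt := fun X => by
  have h : g (J X) X = -g (J X) X := by rw [hg (J X) X, ← hJ, hg]
  have h2 : 2 * g (J X) X = 0 := by rw [two_mul]; nth_rewrite 2 [h]; exact add_neg_cancel _
  exact (mul_eq_zero.mp h2).resolve_left two_ne_zero

theorem exists_map_eq_smul_of_isAlt (b : Module.Basis (Fin 2) K E) (hg₀ : g ≠ 0)
    (hg : ∀ X Y, g X Y = g Y X) (hJ : ∀ X Y, g (J X) Y = -g X (J Y)) (hJ2 : ∀ X, J (J X) = X)
    {B : E →ₗ[K] E →ₗ[K] F} (hB : B.IsAlt) : ∃ w : F, ∀ X Y, B (J X) Y = g X Y • w := by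
  have hβ₀ : g ∘ₗ J ≠ 0 := fun h => hg₀ <| by
    ext X Y
    rw [← hJ2 X]
    exact LinearMap.congr_fun₂ h (J X) Y
  obtain ⟨w, hw⟩ := exists_eq_smul_of_isAlt b (isAlt_comp_of_skew hg hJ) hβ₀ hB
  exact ⟨w, fun X Y => by rw [hw, LinearMap.comp_apply, hJ2]⟩

theorem apply_map_left_of_isAlt (b : Module.Basis (Fin 2) K E) (hg₀ : g ≠ 0)
    (hg : ∀ X Y, g X Y = g Y X) (hJ : ∀ X Y, g (J X) Y = -g X (J Y)) (hJ2 : ∀ X, J (J X) = X)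
    {B : E →ₗ[K] E →ₗ[K] F} (hB : B.IsAlt) (X Y : E) : B (J X) Y = -B X (J Y) := by
  obtain ⟨w, hw⟩ := exists_map_eq_smul_of_isAlt b hg₀ hg hJ hJ2 hB
  rw [hw, hB.neg, hw, hg]

theorem det_eq_neg_one_of_skew_involution (b : Module.Basis (Fin 2) K E) (hg₀ : g ≠ 0)
    (hg : ∀ X Y, g X Y = g Y X) (hJ : ∀ X Y, g (J X) Y = -g X (J Y)) (hJ2 : ∀ X, J (J X) = X) :
    LinearMap.det J = -1 := by
  obtain ⟨X, Y, hXY⟩ : ∃ X Y, g X Y ≠ 0 := by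
    by_contra! h
    exact hg₀ (LinearMap.ext₂ h)
  have h := apply_map_map_of_isAlt b (isAlt_comp_of_skew hg hJ) J (J X) Y
  simp only [LinearMap.comp_apply, hJ2, smul_eq_mul] at h
  refine mul_right_cancel₀ hXY ?_
  rw [← h, hJ, hJ2, neg_one_mul]

end SkewInvolution

section TangentPlane

variable {K E : Type*} [Field K] [AddCommGroup E] [Module K E] {n : Fin 3 → K}
  {D : E →ₗ[K] Fin 3 → K}

/-- The area form `(X, Y) ↦ n · (D X × D Y)` that a linear map `D` with values in the plane
orthogonal to the unit vector `n` pulls back. -/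
def areaForm (n : Fin 3 → K) (D : E →ₗ[K] Fin 3 → K) : E →ₗ[K] E →ₗ[K] K :=
  (crossProduct.compl₁₂ D D).compr₂ (dotProductBilin K K n)

theorem areaForm_apply (X Y : E) : areaForm n D X Y = n ⬝ᵥ D X ⨯₃ D Y := rfl

theorem isAlt_areaForm : (areaForm n D).IsAlt := fun X => by
  rw [areaForm_apply, cross_self, dotProduct_zero]

theorem areaForm_ne_zero (b : Module.Basis (Fin 2) K E) (hn : n ⬝ᵥ n = 1) (hD : ∀ X, n ⬝ᵥ D X = 0)
    (hinj : Function.Injective D) : areaForm n D ≠ 0 := fun h => by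
  have hli : LinearIndependent K ![D (b 0), D (b 1)] := by
    have h := b.linearIndependent.map' D (LinearMap.ker_eq_bot.mpr hinj)
    rwa [← List.ofFn_inj.mp (show List.ofFn ![D (b 0), D (b 1)] = List.ofFn (D ∘ b) from rfl)] at h
  refine crossProduct_ne_zero_iff_linearIndependent.mpr hli ?_
  rw [cross_eq_tripleProduct_smul hn (hD _) (hD _), ← areaForm_apply, h, LinearMap.zero_apply,
    LinearMap.zero_apply, zero_smul]

theorem range_eq_ker_dotProduct (b : Module.Basis (Fin 2) K E) (hn : n ⬝ᵥ n = 1)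
    (hD : ∀ X, n ⬝ᵥ D X = 0) (hinj : Function.Injective D) :
    LinearMap.range D = LinearMap.ker (dotProductBilin K K n) := by
  have hn₀ : dotProductBilin K K n ≠ 0 := fun h =>
    one_ne_zero (hn.symm.trans (LinearMap.congr_fun h n))
  have hker := Module.Dual.finrank_ker_add_one_of_ne_zero hn₀
  rw [Module.finrank_fin_fun] at hker
  refine Submodule.eq_of_le_of_finrank_eq (LinearMap.range_le_iff_comap.mpr ?_) ?_
  · ext X
    simpa using hD X
  · rw [LinearMap.finrank_range_of_inj hinj, Module.finrank_eq_card_basis b,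
      Fintype.card_fin]
    omega

theorem exists_rightAngle_rotation (b : Module.Basis (Fin 2) K E) (hn : n ⬝ᵥ n = 1)
    (hD : ∀ X, n ⬝ᵥ D X = 0) (hinj : Function.Injective D) :
    ∃ R : E →ₗ[K] E, (∀ X, D (R X) = n ⨯₃ D X) ∧ LinearMap.det R = 1 := by
  obtain ⟨D', hD'⟩ := D.exists_leftInverse_of_injective (LinearMap.ker_eq_bot.mpr hinj)
  have hR : ∀ X, D (D' (n ⨯₃ D X)) = n ⨯₃ D X := fun X => by
    obtain ⟨Y, hY⟩ : n ⨯₃ D X ∈ LinearMap.range D := by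
      rw [range_eq_ker_dotProduct b hn hD hinj]
      exact dot_self_cross n (D X)
    rw [← hY, ← LinearMap.comp_apply D', hD', LinearMap.id_apply]
  refine ⟨D' ∘ₗ crossProduct n ∘ₗ D, hR, ?_⟩
  obtain ⟨X, Y, hXY⟩ : ∃ X Y, areaForm n D X Y ≠ 0 := by
    by_contra! h
    exact areaForm_ne_zero b hn hD hinj (LinearMap.ext₂ h)
  refine mul_right_cancel₀ hXY ?_
  rw [← smul_eq_mul, ← apply_map_map_of_isAlt b isAlt_areaForm, one_mul]
  simp only [areaForm_apply, LinearMap.comp_apply, hR]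
  rw [triple_product_permutation, triple_product_permutation,
    cross_cross_of_dotProduct_eq_zero hn (hD X), dotProduct_neg, dotProduct_comm,
    triple_product_permutation, ← dotProduct_neg, cross_anticomm]

end TangentPlane

/-! ### Calculus -/

section ProductRules

variable {𝕜 E F V W n : Type*} [NontriviallyNormedField 𝕜] [CompleteSpace 𝕜]
  [NormedAddCommGroup E] [NormedSpace 𝕜 E] [NormedAddCommGroup F] [NormedSpace 𝕜 F]
  [NormedAddCommGroup V] [NormedSpace 𝕜 V] [FiniteDimensional 𝕜 V]
  [NormedAddCommGroup W] [NormedSpace 𝕜 W] [FiniteDimensional 𝕜 W] [Fintype n] {y : E}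

theorem fderiv_bilinear_apply (B : V →ₗ[𝕜] W →ₗ[𝕜] F) {f : E → V} {g : E → W}
    (hf : DifferentiableAt 𝕜 f y) (hg : DifferentiableAt 𝕜 g y) (v : E) :
    fderiv 𝕜 (fun z => B (f z) (g z)) y v =
      B (fderiv 𝕜 f y v) (g y) + B (f y) (fderiv 𝕜 g y v) := by
  have h := DFunLike.congr_fun (B.toContinuousBilinearMap.fderiv_of_bilinear hf hg) v
  rw [add_comm]
  exact h

theorem fderiv_cross {f g : E → Fin 3 → 𝕜} (hf : DifferentiableAt 𝕜 f y)
    (hg : DifferentiableAt 𝕜 g y) (v : E) :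
    fderiv 𝕜 (fun z => f z ⨯₃ g z) y v = fderiv 𝕜 f y v ⨯₃ g y + f y ⨯₃ fderiv 𝕜 g y v :=
  fderiv_bilinear_apply crossProduct hf hg v

theorem fderiv_dotProduct {f g : E → n → 𝕜} (hf : DifferentiableAt 𝕜 f y)
    (hg : DifferentiableAt 𝕜 g y) (v : E) :
    fderiv 𝕜 (fun z => f z ⬝ᵥ g z) y v = fderiv 𝕜 f y v ⬝ᵥ g y + f y ⬝ᵥ fderiv 𝕜 g y v :=
  fderiv_bilinear_apply (dotProductBilin 𝕜 𝕜) hf hg v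

theorem contDiffOn_bilinear_apply (B : V →ₗ[𝕜] W →ₗ[𝕜] F) {f : E → V} {g : E → W} {s : Set E}
    {k : ℕ∞ω} (hf : ContDiffOn 𝕜 k f s) (hg : ContDiffOn 𝕜 k g s) :
    ContDiffOn 𝕜 k (fun z => B (f z) (g z)) s :=
  B.toContinuousBilinearMap.isBoundedBilinearMap.contDiff.comp₂_contDiffOn hf hg

end ProductRules

section MulVec

variable {𝕜 E m n : Type*} [NontriviallyNormedField 𝕜] [NormedAddCommGroup E] [NormedSpace 𝕜 E]
  [Fintype n] {y : E}

theorem differentiableAt_mulVec {A : E → Matrix m n 𝕜} {w : E → n → 𝕜}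
    (hA : ∀ i j, DifferentiableAt 𝕜 (fun z => A z i j) y) (hw : DifferentiableAt 𝕜 w y) :
    DifferentiableAt 𝕜 (fun z => A z *ᵥ w z) y :=
  differentiableAt_pi.mpr fun i => DifferentiableAt.fun_sum fun j _ =>
    (hA i j).mul (differentiableAt_pi.mp hw j)

theorem fderiv_mulVec [Finite m] {A : E → Matrix m n 𝕜} {w : E → n → 𝕜}
    (hA : ∀ i j, DifferentiableAt 𝕜 (fun z => A z i j) y) (hw : DifferentiableAt 𝕜 w y) (v : E) :
    fderiv 𝕜 (fun z => A z *ᵥ w z) y v =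
      fderiv 𝕜 (fun z => A z *ᵥ w y) y v + A y *ᵥ fderiv 𝕜 w y v := by
  have := Fintype.ofFinite m
  have entry (w' : E → n → 𝕜) (hw' : DifferentiableAt 𝕜 w' y) (i : m) :
      fderiv 𝕜 (fun z => A z *ᵥ w' z) y v i =
        ∑ j, (A y i j * fderiv 𝕜 w' y v j + w' y j * fderiv 𝕜 (fun z => A z i j) y v) := by
    have hsum := HasFDerivAt.fun_sum fun j (_ : j ∈ Finset.univ) =>
      (hA i j).hasFDerivAt.fun_mul (hasFDerivAt_pi'.mp hw'.hasFDerivAt j)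
    have hi := DFunLike.congr_fun (hsum.unique
      (hasFDerivAt_pi'.mp (differentiableAt_mulVec hA hw').hasFDerivAt i)) v
    simpa using hi.symm
  ext i
  rw [Pi.add_apply, entry w hw, entry _ (differentiableAt_const _), Matrix.mulVec, dotProduct,
    ← Finset.sum_add_distrib]
  refine Finset.sum_congr rfl fun j _ => ?_
  simp [add_comm]

theorem deriv_mulVec [Finite m] {A : 𝕜 → Matrix m n 𝕜} {w : 𝕜 → n → 𝕜} {t : 𝕜}
    (hA : ∀ i j, DifferentiableAt 𝕜 (fun s => A s i j) t) (hw : DifferentiableAt 𝕜 w t) :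
    deriv (fun s => A s *ᵥ w s) t = deriv (fun s => A s *ᵥ w t) t + A t *ᵥ deriv w t := by
  have := Fintype.ofFinite m
  simp only [← fderiv_apply_one_eq_deriv]
  exact fderiv_mulVec hA hw 1

end MulVec

section SecondDerivatives

variable {E F : Type*} [NormedAddCommGroup E] [NormedSpace ℝ E] [NormedAddCommGroup F]
  [NormedSpace ℝ F]

theorem fderiv_fderiv_apply {f : E → F} {y : E} (hf : ContDiffAt ℝ 2 f y) (v w : E) :
    fderiv ℝ (fun z => fderiv ℝ f z v) y w = fderiv ℝ (fderiv ℝ f) y w v := by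
  have hd : DifferentiableAt ℝ (fderiv ℝ f) y :=
    (hf.fderiv_right (m := 1) (by norm_num)).differentiableAt one_ne_zero
  rw [fderiv_clm_apply hd (differentiableAt_const v)]
  simp

theorem fderiv_fderiv_apply_comm {f : E → F} {y : E} (hf : ContDiffAt ℝ 2 f y) (v w : E) :
    fderiv ℝ (fun z => fderiv ℝ f z v) y w = fderiv ℝ (fun z => fderiv ℝ f z w) y v := by
  rw [fderiv_fderiv_apply hf, fderiv_fderiv_apply hf]
  exact hf.isSymmSndFDerivAt (by simp) w v

theorem deriv_prodMk_left {G : ℝ × E → F} {t : ℝ} {y : E} (hG : DifferentiableAt ℝ G (t, y)) :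
    deriv (fun s => G (s, y)) t = fderiv ℝ G (t, y) (1, 0) :=
  (hG.hasFDerivAt.comp_hasDerivAt t ((hasDerivAt_id t).prodMk (hasDerivAt_const t y))).deriv

theorem contDiffOn_deriv_prodMk_left {G : ℝ × E → F} {t : ℝ} {s : Set E}
    (hG : ∀ y ∈ s, ContDiffAt ℝ ∞ G (t, y)) :
    ContDiffOn ℝ ∞ (fun y => deriv (fun r => G (r, y)) t) s := by
  refine ContDiffOn.congr (f := fun y => fderiv ℝ G (t, y) (1, 0)) (fun y hy => ?_)
    fun y hy => deriv_prodMk_left ((hG y hy).differentiableAt (by simp))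
  have hslice : ContDiffAt ℝ ∞ (fun z : E => (t, z)) y := contDiffAt_const.prodMk contDiffAt_id
  exact ((((hG y hy).fderiv_right (m := ∞) le_rfl).comp y hslice).clm_apply
    contDiffAt_const).contDiffWithinAt

theorem fderiv_prodMk_right {G : ℝ × E → F} {t : ℝ} {y : E} (hG : DifferentiableAt ℝ G (t, y))
    (v : E) : fderiv ℝ (fun z => G (t, z)) y v = fderiv ℝ G (t, y) (0, v) :=
  DFunLike.congr_fun (hG.hasFDerivAt.comp y (hasFDerivAt_prodMk_right t y)).fderiv v

theorem fderiv_deriv_comm {G : ℝ × E → F} {t : ℝ} {y : E} (hG : ContDiffAt ℝ 2 G (t, y)) (v : E) :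
    fderiv ℝ (fun z => deriv (fun s => G (s, z)) t) y v =
      deriv (fun s => fderiv ℝ (fun z => G (s, z)) y v) t := by
  have hd : ∀ᶠ p in 𝓝 (t, y), DifferentiableAt ℝ G p :=
    (hG.eventually (by simp)).mono fun p hp => hp.differentiableAt two_ne_zero
  have hd' (w : ℝ × E) : DifferentiableAt ℝ (fun p => fderiv ℝ G p w) (t, y) :=
    ((hG.fderiv_right (m := 1) (by norm_num)).differentiableAt one_ne_zero).clm_apply
      (differentiableAt_const w)
  have hleft : (fun z => deriv (fun s => G (s, z)) t) =ᶠ[𝓝 y] fun z => fderiv ℝ G (t, z) (1, 0) :=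
    ((Continuous.prodMk_right t).tendsto y |>.eventually hd).mono fun z => deriv_prodMk_left
  have hright : (fun s => fderiv ℝ (fun z => G (s, z)) y v) =ᶠ[𝓝 t]
      fun s => fderiv ℝ G (s, y) (0, v) :=
    ((Continuous.prodMk_left y).tendsto t |>.eventually hd).mono fun s hs =>
      fderiv_prodMk_right hs v
  rw [hleft.fderiv_eq, hright.deriv_eq, fderiv_prodMk_right (hd' (1, 0)),
    deriv_prodMk_left (hd' (0, v)), fderiv_fderiv_apply_comm hG]

theorem contDiffOn_fderiv_apply {f : E → F} {s : Set E} (hs : IsOpen s) (hf : ContDiffOn ℝ ∞ f s)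
    {v : E → E} (hv : ContDiffOn ℝ ∞ v s) : ContDiffOn ℝ ∞ (fun z => fderiv ℝ f z (v z)) s :=
  (hf.fderiv_of_isOpen hs le_rfl).clm_apply hv

theorem fderiv_congr_of_isOpen {f g : E → F} {s : Set E} (hs : IsOpen s) (h : s.EqOn f g) {y : E}
    (hy : y ∈ s) : fderiv ℝ f y = fderiv ℝ g y :=
  (h.eventuallyEq_of_mem (hs.mem_nhds hy)).fderiv_eq

theorem exists_contDiffOn_primitive [CompleteSpace F] {θ : E → E →L[ℝ] F} {s : Set E}
    (hs : IsOpen s) (hsc : Convex ℝ s) (hθ : ContDiffOn ℝ ∞ θ s)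
    (hclosed : ∀ y ∈ s, ∀ v w, fderiv ℝ θ y v w = fderiv ℝ θ y w v) :
    ∃ f : E → F, ContDiffOn ℝ ∞ f s ∧ ∀ y ∈ s, fderiv ℝ f y = θ y := by
  obtain ⟨f, hf⟩ := hsc.exists_forall_hasFDerivAt_of_fderiv_symmetric hs
    (hθ.differentiableOn (by simp)) hclosed
  have hfd : ∀ y ∈ s, fderiv ℝ f y = θ y := fun y hy => (hf y hy).fderiv
  refine ⟨f, (contDiffOn_infty_iff_fderiv_of_isOpen hs).mpr ⟨fun y hy => ?_, hθ.congr hfd⟩, hfd⟩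
  exact (hf y hy).differentiableAt.differentiableWithinAt

theorem eventually_eq_of_fderiv_eq_zero {f : E → F} {y : E}
    (hf : ∀ᶠ z in 𝓝 y, DifferentiableAt ℝ f z ∧ fderiv ℝ f z = 0) : ∀ᶠ z in 𝓝 y, f z = f y := by
  obtain ⟨r, hr, h⟩ := Metric.eventually_nhds_iff_ball.mp hf
  filter_upwards [Metric.ball_mem_nhds y hr] with z hz
  exact Metric.isOpen_ball.is_const_of_fderiv_eq_zero (𝕜 := ℝ) (convex_ball y r).isPreconnected
    (fun z hz => (h z hz).1.differentiableWithinAt) (fun z hz => (h z hz).2) hz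
    (Metric.mem_ball_self hr)

end SecondDerivatives

/-! ### Charts -/

section Charts

variable {E F M : Type*} [NormedAddCommGroup E] [NormedSpace ℝ E] [NormedAddCommGroup F]
  [NormedSpace ℝ F] [TopologicalSpace M] [ChartedSpace E M] {e : OpenPartialHomeomorph M E} {y : E}

/-- The coordinate frame of a chart `e`, as the differential of the parametrisation `e.symm`: it
maps coordinate vectors to tangent vectors. -/
noncomputable abbrev chartFrame (e : OpenPartialHomeomorph M E) (y : E) :
    E →L[ℝ] TangentSpace 𝓘(ℝ, E) (e.symm y) :=
  mfderiv 𝓘(ℝ, E) 𝓘(ℝ, E) e.symm y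

theorem mdifferentiable_of_mem_maximalAtlas (he : e ∈ IsManifold.maximalAtlas 𝓘(ℝ, E) ∞ M) :
    e.MDifferentiable 𝓘(ℝ, E) 𝓘(ℝ, E) :=
  ⟨(contMDiffOn_of_mem_maximalAtlas he).mdifferentiableOn (by simp),
    (contMDiffOn_symm_of_mem_maximalAtlas he).mdifferentiableOn (by simp)⟩

theorem exists_mem_maximalAtlas_symm_eq [IsManifold 𝓘(ℝ, E) ∞ M] (x : M) :
    ∃ e ∈ IsManifold.maximalAtlas 𝓘(ℝ, E) ∞ M, ∃ y ∈ e.target, e.symm y = x :=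
  ⟨chartAt E x, IsManifold.chart_mem_maximalAtlas x, chartAt E x x,
    mem_chart_target E x, (chartAt E x).left_inv (mem_chart_source E x)⟩

theorem chartFrame_bijective (he : e ∈ IsManifold.maximalAtlas 𝓘(ℝ, E) ∞ M) (hy : y ∈ e.target) :
    Function.Bijective (chartFrame e y) :=
  (mdifferentiable_of_mem_maximalAtlas he).symm.mfderiv_bijective hy

theorem chartFrame_mfderiv (he : e ∈ IsManifold.maximalAtlas 𝓘(ℝ, E) ∞ M) (hy : y ∈ e.target)
    (X : TangentSpace 𝓘(ℝ, E) (e.symm y)) :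
    chartFrame e y (mfderiv 𝓘(ℝ, E) 𝓘(ℝ, E) e (e.symm y) X) = X := by
  have h := (mdifferentiable_of_mem_maximalAtlas he).symm_comp_deriv (e.map_target hy)
  rw [e.right_inv hy] at h
  exact DFunLike.congr_fun h X

theorem contDiffOn_comp_symm (he : e ∈ IsManifold.maximalAtlas 𝓘(ℝ, E) ∞ M) {f : M → F}
    {s : Set M} (hf : ContMDiffOn 𝓘(ℝ, E) 𝓘(ℝ, F) ∞ f s) (hs : e.source ⊆ s) :
    ContDiffOn ℝ ∞ (f ∘ e.symm) e.target :=
  contMDiffOn_iff_contDiffOn.mp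
    (hf.comp (contMDiffOn_symm_of_mem_maximalAtlas he) fun _ hy => hs (e.map_target hy))

theorem fderiv_comp_symm (he : e ∈ IsManifold.maximalAtlas 𝓘(ℝ, E) ∞ M) (hy : y ∈ e.target)
    {f : M → F} (hf : MDifferentiableAt 𝓘(ℝ, E) 𝓘(ℝ, F) f (e.symm y)) (v : E) :
    fderiv ℝ (f ∘ e.symm) y v = mfderiv 𝓘(ℝ, E) 𝓘(ℝ, F) f (e.symm y) (chartFrame e y v) := by
  rw [← mfderiv_eq_fderiv]
  exact mfderiv_comp_apply y hf
    ((mdifferentiable_of_mem_maximalAtlas he).mdifferentiableAt_symm hy) v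

theorem eventually_eq_of_mfderiv_eq_zero [IsManifold 𝓘(ℝ, E) ∞ M] {f : M → F} {x : M}
    (hf : ∀ᶠ p in 𝓝 x, MDifferentiableAt 𝓘(ℝ, E) 𝓘(ℝ, F) f p ∧ mfderiv 𝓘(ℝ, E) 𝓘(ℝ, F) f p = 0) :
    ∀ᶠ p in 𝓝 x, f p = f x := by
  obtain ⟨e, he, y, hy, rfl⟩ := exists_mem_maximalAtlas_symm_eq (E := E) x
  have hchart : ∀ᶠ z in 𝓝 y, DifferentiableAt ℝ (f ∘ e.symm) z ∧ fderiv ℝ (f ∘ e.symm) z = 0 := by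
    filter_upwards [(e.continuousAt_symm hy).eventually hf, e.open_target.mem_nhds hy]
      with z ⟨hd, h0⟩ hz
    refine ⟨(hd.comp z ((mdifferentiable_of_mem_maximalAtlas he).mdifferentiableAt_symm
      hz)).differentiableAt, ContinuousLinearMap.ext fun v => ?_⟩
    rw [fderiv_comp_symm he hz hd, h0]
    rfl
  have hconst := eventually_eq_of_fderiv_eq_zero hchart
  have hcont := e.continuousAt (e.map_target hy)
  rw [ContinuousAt, e.right_inv hy] at hcont
  filter_upwards [hcont.eventually hconst, e.open_source.mem_nhds (e.map_target hy)] with p hp hpe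
  simpa [e.left_inv hpe] using hp

theorem eq_of_mfderiv_eq_zero [IsManifold 𝓘(ℝ, E) ∞ M] {f : M → F} {V : Set M} (hV : IsOpen V)
    (hVc : IsPreconnected V) (hf : MDifferentiableOn 𝓘(ℝ, E) 𝓘(ℝ, F) f V)
    (h0 : ∀ x ∈ V, mfderiv 𝓘(ℝ, E) 𝓘(ℝ, F) f x = 0) {x y : M} (hx : x ∈ V) (hy : y ∈ V) :
    f x = f y := by
  refine hVc.induction₂ (fun p q => f p = f q) (fun p hp => ?_)
    (fun _ _ _ _ _ _ => Eq.trans) (fun _ _ _ _ => Eq.symm) hx hy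
  refine ((eventually_eq_of_mfderiv_eq_zero (E := E) ?_).mono fun q => Eq.symm).filter_mono
    nhdsWithin_le_nhds
  filter_upwards [hV.mem_nhds hp] with q hq
  exact ⟨(hf q hq).mdifferentiableAt (hV.mem_nhds hq), h0 q hq⟩

theorem dotProduct_mfderiv_eq_zero {n : Type*} [Fintype n] {f : M → n → ℝ} {x : M} {r : ℝ}
    (hf : MDifferentiableAt 𝓘(ℝ, E) 𝓘(ℝ, n → ℝ) f x) (h : ∀ᶠ p in 𝓝 x, f p ⬝ᵥ f p = r)
    (X : TangentSpace 𝓘(ℝ, E) x) : f x ⬝ᵥ mfderiv 𝓘(ℝ, E) 𝓘(ℝ, n → ℝ) f x X = 0 := by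
  have hsq (v : n → ℝ) : fderiv ℝ (fun u : n → ℝ => u ⬝ᵥ u) (f x) v = 2 * (f x ⬝ᵥ v) := by
    have h := fderiv_dotProduct (differentiableAt_fun_id (𝕜 := ℝ) (x := f x))
      differentiableAt_fun_id v
    rw [fderiv_fun_id, ContinuousLinearMap.id_apply, dotProduct_comm v] at h
    rw [h, two_mul]
  have hd : MDifferentiableAt 𝓘(ℝ, n → ℝ) 𝓘(ℝ, ℝ) (fun u : n → ℝ => u ⬝ᵥ u) (f x) :=
    DifferentiableAt.mdifferentiableAt <| DifferentiableAt.fun_sum fun i _ =>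
      (differentiableAt_apply i _).fun_mul (differentiableAt_apply i _)
  have hcomp : mfderiv 𝓘(ℝ, E) 𝓘(ℝ, ℝ) (fun p => f p ⬝ᵥ f p) x X = (0 : ℝ) := by
    rw [Filter.EventuallyEq.mfderiv_eq (f := fun _ => r) h, mfderiv_const]
    rfl
  have hchain : mfderiv 𝓘(ℝ, E) 𝓘(ℝ, ℝ) (fun p => f p ⬝ᵥ f p) x X =
      2 * (f x ⬝ᵥ mfderiv 𝓘(ℝ, E) 𝓘(ℝ, n → ℝ) f x X) := by
    refine (mfderiv_comp_apply x hd hf X).trans ?_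
    rw [mfderiv_eq_fderiv]
    exact hsq _
  exact (mul_eq_zero.mp (hchain.symm.trans hcomp)).resolve_left two_ne_zero

end Charts

/-! ### Conformal structures -/

section ConformalStructure

variable {M : Type*} [TopologicalSpace M] [ChartedSpace Plane M]

theorem chartFrame_coordEndo {e : OpenPartialHomeomorph M Plane}
    (he : e ∈ IsManifold.maximalAtlas 𝓘(ℝ, Plane) ∞ M)
    (J : ∀ x : M, TangentSpace 𝓘(ℝ, Plane) x →L[ℝ] TangentSpace 𝓘(ℝ, Plane) x)
    {y : Plane} (hy : y ∈ e.target) (v : Plane) :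
    chartFrame e y (coordEndo J e y v) = J (e.symm y) (chartFrame e y v) :=
  chartFrame_mfderiv he hy _

/-- The standard basis of the plane, as a basis of the tangent spaces of a surface. -/
noncomputable def tangentBasis (x : M) : Module.Basis (Fin 2) ℝ (TangentSpace 𝓘(ℝ, Plane) x) :=
  Module.Basis.finTwoProd ℝ

namespace LorentzConformalStructure

variable {F : Type*} [AddCommGroup F] [Module ℝ F] (c : LorentzConformalStructure M) {x : M}
  {B : TangentSpace 𝓘(ℝ, Plane) x →ₗ[ℝ] TangentSpace 𝓘(ℝ, Plane) x →ₗ[ℝ] F}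

theorem g_ne_zero (x : M) : (c.g x).toLinearMap₁₂ ≠ 0 := fun h => by
  obtain ⟨X, hX⟩ := c.g_pos x
  exact hX.ne' (LinearMap.congr_fun₂ h X X)

theorem exists_J_left_eq_g_smul (hB : B.IsAlt) : ∃ w : F, ∀ X Y, B (c.J x X) Y = c.g x X Y • w :=
  exists_map_eq_smul_of_isAlt (J := (c.J x).toLinearMap) (tangentBasis x) (c.g_ne_zero x)
    (c.g_symm x) (c.J_skew x) (c.J_sq x) hB

theorem apply_J_left_of_isAlt (hB : B.IsAlt) (X Y : TangentSpace 𝓘(ℝ, Plane) x) :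
    B (c.J x X) Y = -B X (c.J x Y) :=
  apply_map_left_of_isAlt (J := (c.J x).toLinearMap) (tangentBasis x) (c.g_ne_zero x)
    (c.g_symm x) (c.J_skew x) (c.J_sq x) hB X Y

theorem det_J (x : M) : LinearMap.det (c.J x).toLinearMap = -1 :=
  det_eq_neg_one_of_skew_involution (tangentBasis x) (c.g_ne_zero x)
    (c.g_symm x) (c.J_skew x) (c.J_sq x)

/-- The endomorphism `s π⁺ + s⁻¹ π⁻` of the tangent spaces, where `π^±` are the projections onto
the null directions `{J X = ±X}`.  It is the effect of the spectral parameter `s` on differentials: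
`𝒩 + (d_s - d) = 𝒩 ∘ boost`. -/
noncomputable def boost (s : ℝ) (x : M) :
    TangentSpace 𝓘(ℝ, Plane) x →L[ℝ] TangentSpace 𝓘(ℝ, Plane) x :=
  ((s + s⁻¹) / 2) • ContinuousLinearMap.id ℝ _ + ((s - s⁻¹) / 2) • c.J x

variable {s : ℝ} {X : TangentSpace 𝓘(ℝ, Plane) x}

theorem boost_apply (s : ℝ) (X : TangentSpace 𝓘(ℝ, Plane) x) :
    c.boost s x X = ((s + s⁻¹) / 2) • X + ((s - s⁻¹) / 2) • c.J x X := rfl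

theorem J_boost (s : ℝ) (X : TangentSpace 𝓘(ℝ, Plane) x) :
    c.J x (c.boost s x X) = c.boost s x (c.J x X) := by
  simp only [boost_apply, map_add, map_smul]

theorem boost_inv_boost (hs : s ≠ 0) (X : TangentSpace 𝓘(ℝ, Plane) x) :
    c.boost s⁻¹ x (c.boost s x X) = X := by
  simp only [boost_apply, map_add, map_smul, c.J_sq, inv_inv]
  match_scalars <;> field_simp <;> ring

theorem boost_injective (hs : s ≠ 0) (x : M) : Function.Injective (c.boost s x) :=
  Function.LeftInverse.injective (c.boost_inv_boost hs)

theorem boost_of_J_eq (hX : c.J x X = X) (s : ℝ) : c.boost s x X = s • X := by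
  rw [boost_apply, hX]; module

theorem boost_of_J_eq_neg (hX : c.J x X = -X) (s : ℝ) : c.boost s x X = s⁻¹ • X := by
  rw [boost_apply, hX]; module

theorem hasDerivAt_map_boost {G : Type*} [NormedAddCommGroup G] [NormedSpace ℝ G]
    (D : TangentSpace 𝓘(ℝ, Plane) x →L[ℝ] G) (hs : s ≠ 0) (X : TangentSpace 𝓘(ℝ, Plane) x) :
    HasDerivAt (fun t => D (c.boost t x X)) (s⁻¹ • D (c.boost s x (c.J x X))) s := by
  have hp := (((hasDerivAt_id s).add (hasDerivAt_inv hs)).div_const 2).smul_const (D X)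
  have hm := (((hasDerivAt_id s).sub (hasDerivAt_inv hs)).div_const 2).smul_const (D (c.J x X))
  simp only [boost_apply, map_add, map_smul, c.J_sq]
  refine (hp.add hm).congr_deriv ?_
  match_scalars <;> field_simp <;> ring

end LorentzConformalStructure

end ConformalStructure

section Gauge

variable {M : Type*} [TopologicalSpace M] [ChartedSpace Plane M]
  {c : LorentzConformalStructure M} {N : M → R3} {e : OpenPartialHomeomorph M Plane}

namespace IsHarmonic

variable (hN : IsHarmonic c N)
include hN

theorem mdifferentiableAt (x : M) : MDifferentiableAt 𝓘(ℝ, Plane) 𝓘(ℝ, R3) N x :=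
  (hN.smooth x).mdifferentiableAt (by simp)

theorem dotProduct_d (x : M) (X : TangentSpace 𝓘(ℝ, Plane) x) : N x ⬝ᵥ d N x X = 0 :=
  dotProduct_mfderiv_eq_zero (hN.mdifferentiableAt x) (.of_forall hN.unit) X

theorem contDiffOn_chart (he : e ∈ IsManifold.maximalAtlas 𝓘(ℝ, Plane) ∞ M) :
    ContDiffOn ℝ ∞ (N ∘ e.symm) e.target :=
  contDiffOn_comp_symm he hN.smooth.contMDiffOn (Set.subset_univ _)

variable {y : Plane}

theorem fderiv_chart (he : e ∈ IsManifold.maximalAtlas 𝓘(ℝ, Plane) ∞ M) (hy : y ∈ e.target)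
    (v : Plane) : fderiv ℝ (N ∘ e.symm) y v = d N (e.symm y) (chartFrame e y v) :=
  fderiv_comp_symm he hy (hN.mdifferentiableAt _) v

theorem fderiv_chart_coordEndo (he : e ∈ IsManifold.maximalAtlas 𝓘(ℝ, Plane) ∞ M)
    (hy : y ∈ e.target) (v : Plane) :
    fderiv ℝ (N ∘ e.symm) y (coordEndo c.J e y v) =
      d N (e.symm y) (c.J (e.symm y) (chartFrame e y v)) := by
  rw [hN.fderiv_chart he hy, chartFrame_coordEndo he c.J hy]

theorem contDiffOn_fderiv_coordEndo (he : e ∈ IsManifold.maximalAtlas 𝓘(ℝ, Plane) ∞ M)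
    (v : Plane) :
    ContDiffOn ℝ ∞ (fun z => fderiv ℝ (N ∘ e.symm) z (coordEndo c.J e z v)) e.target :=
  contDiffOn_fderiv_apply e.open_target (hN.contDiffOn_chart he) (c.J_smooth e he v)

end IsHarmonic

/-! ### Trivialising gauges -/

section Complexification

/-- The inclusion `ℝ³ ⊆ ℂ³` as a continuous linear map. -/
noncomputable def toCL : R3 →L[ℝ] C3 :=
  ContinuousLinearMap.pi fun i => Complex.ofRealCLM.comp (ContinuousLinearMap.proj i)

theorem toC_injective : Function.Injective toC := fun _ _ h =>
  funext fun i => Complex.ofReal_injective (congrFun h i)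

theorem toC_add (u v : R3) : toC (u + v) = toC u + toC v := map_add toCL u v

theorem toC_sub (u v : R3) : toC (u - v) = toC u - toC v := map_sub toCL u v

theorem toC_smul (r : ℝ) (v : R3) : toC (r • v) = (r : ℂ) • toC v := map_smul toCL r v

theorem toC_cross (u v : R3) : toC (u ⨯₃ v) = toC u ⨯₃ toC v := by
  ext i
  fin_cases i <;> simp [toC, cross_apply]

theorem toC_mulVec (A : Matrix (Fin 3) (Fin 3) ℝ) (v : R3) :
    toC (A *ᵥ v) = A.map Complex.ofReal *ᵥ toC v :=
  funext fun i => RingHom.map_mulVec Complex.ofRealHom A v i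

theorem dC_toC {f : M → R3} {x : M} (hf : MDifferentiableAt 𝓘(ℝ, Plane) 𝓘(ℝ, R3) f x)
    (X : TangentSpace 𝓘(ℝ, Plane) x) : dC (fun y => toC (f y)) x X = toC (d f x X) := by
  have h := (toCL.hasFDerivAt (x := f x)).hasMFDerivAt.comp x hf.hasMFDerivAt
  exact DFunLike.congr_fun h.mfderiv X

theorem dLam_toC {f : M → R3} {x : M} (hf : MDifferentiableAt 𝓘(ℝ, Plane) 𝓘(ℝ, R3) f x) (s : ℝ)
    (X : TangentSpace 𝓘(ℝ, Plane) x) :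
    dLam c N s (fun y => toC (f y)) x X =
      toC (d f x X + (N x ⨯₃ d N x (c.boost s x X - X)) ⨯₃ f x) := by
  simp only [dLam, calD, calNPlus, calNMinus, calN, dC_toC hf, c.boost_apply, map_add, map_sub,
    map_smul, LinearMap.add_apply, LinearMap.sub_apply, LinearMap.smul_apply, toC_add, toC_sub,
    toC_smul, ← toC_cross]
  push_cast
  module

end Complexification

namespace IsTrivialisingGauge

variable {s : ℝ} {T : M → Matrix (Fin 3) (Fin 3) ℝ}
  (hT : IsTrivialisingGauge c N (s : ℂ) (fun x => (T x).map Complex.ofReal))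
include hT

theorem real_smooth (i j : Fin 3) : ContMDiff 𝓘(ℝ, Plane) 𝓘(ℝ, ℝ) ∞ (fun x => T x i j) :=
  (Complex.reCLM.contDiff (n := ∞)).contMDiff.comp (hT.smooth i j)

theorem real_orth (x : M) : T x * (T x)ᵀ = 1 := by
  have h := hT.orth x
  rw [← Matrix.transpose_map] at h
  apply Matrix.map_injective Complex.ofReal_injective
  dsimp only
  rw [Matrix.map_one _ Complex.ofReal_zero Complex.ofReal_one, ← h]
  exact Matrix.map_mul (f := Complex.ofRealHom)

theorem real_det (x : M) : (T x).det = 1 := by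
  have h := hT.det x
  apply Complex.ofReal_injective
  rw [Complex.ofReal_one, ← h]
  exact RingHom.map_det Complex.ofRealHom (T x)

theorem mulVec_smooth {f : M → R3} (hf : ContMDiff 𝓘(ℝ, Plane) 𝓘(ℝ, R3) ∞ f) :
    ContMDiff 𝓘(ℝ, Plane) 𝓘(ℝ, R3) ∞ (fun x => T x *ᵥ f x) :=
  contMDiff_pi_space.mpr fun i => contMDiff_finsetSum (t := Finset.univ) fun j _ =>
    (hT.real_smooth i j).mul (contMDiff_pi_space.mp hf j)

theorem d_mulVec {f : M → R3} (hf : ContMDiff 𝓘(ℝ, Plane) 𝓘(ℝ, R3) ∞ f) (x : M)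
    (X : TangentSpace 𝓘(ℝ, Plane) x) :
    d (fun y => T y *ᵥ f y) x X =
      T x *ᵥ (d f x X + (N x ⨯₃ d N x (c.boost s x X - X)) ⨯₃ f x) := by
  have h := hT.gauge (fun y => toC (f y)) ((toCL.contDiff (n := ∞)).contMDiff.comp hf) x X
  rw [dLam_toC ((hf x).mdifferentiableAt (by simp))] at h
  simp only [← toC_mulVec] at h
  rw [dC_toC ((hT.mulVec_smooth hf x).mdifferentiableAt (by simp))] at h
  exact (toC_injective h).symm

theorem fderiv_mulVec_chart (he : e ∈ IsManifold.maximalAtlas 𝓘(ℝ, Plane) ∞ M) {y : Plane}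
    (hy : y ∈ e.target) {w : Plane → R3} (hw : DifferentiableAt ℝ w y) (v : Plane) :
    fderiv ℝ (fun z => T (e.symm z) *ᵥ w z) y v = T (e.symm y) *ᵥ
      ((N (e.symm y) ⨯₃ d N (e.symm y)
        (c.boost s (e.symm y) (chartFrame e y v) - chartFrame e y v)) ⨯₃ w y +
          fderiv ℝ w y v) := by
  have hT' (i j : Fin 3) : DifferentiableAt ℝ (fun z => T (e.symm z) i j) y :=
    ((contDiffOn_comp_symm he (hT.real_smooth i j).contMDiffOn (Set.subset_univ _)).contDiffAt
      (e.open_target.mem_nhds hy)).differentiableAt (by simp)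
  have hconst : ContMDiff 𝓘(ℝ, Plane) 𝓘(ℝ, R3) ∞ (fun _ : M => w y) := contMDiff_const
  have hfrozen : fderiv ℝ (fun z => T (e.symm z) *ᵥ w y) y v =
      d (fun x => T x *ᵥ w y) (e.symm y) (chartFrame e y v) :=
    fderiv_comp_symm he hy ((hT.mulVec_smooth hconst _).mdifferentiableAt (by simp)) v
  rw [fderiv_mulVec hT' hw, hfrozen, hT.d_mulVec hconst, d, mfderiv_const, Matrix.mulVec_add,
    Matrix.mulVec_add]
  change T (e.symm y) *ᵥ 0 + _ + _ = _
  rw [Matrix.mulVec_zero, zero_add]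

theorem mulVec_cross_fderiv_mulVec (he : e ∈ IsManifold.maximalAtlas 𝓘(ℝ, Plane) ∞ M) {y : Plane}
    (hy : y ∈ e.target) {w : Plane → R3} (hw : DifferentiableAt ℝ w y)
    (hNw : N (e.symm y) ⬝ᵥ w y = 0) (v : Plane) :
    (T (e.symm y) *ᵥ N (e.symm y)) ⨯₃ fderiv ℝ (fun z => T (e.symm z) *ᵥ w z) y v =
      T (e.symm y) *ᵥ (N (e.symm y) ⨯₃ fderiv ℝ w y v) := by
  rw [hT.fderiv_mulVec_chart he hy hw, mulVec_cross_mulVec (hT.real_orth _) (hT.real_det _),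
    map_add, cross_cross_eq_zero (dot_self_cross _ _) hNw, zero_add]

variable (hN : IsHarmonic c N)
include hN

theorem d_transform (x : M) (X : TangentSpace 𝓘(ℝ, Plane) x) :
    d (fun y => T y *ᵥ N y) x X = T x *ᵥ d N x (c.boost s x X) := by
  rw [hT.d_mulVec hN.smooth,
    cross_cross_self_of_dotProduct_eq_zero (hN.unit x) (hN.dotProduct_d x _), map_sub,
    add_sub_cancel]

theorem injective_d_transform (hs : s ≠ 0) {x : M} (hi : Function.Injective (d N x)) :
    Function.Injective (d (fun y => T y *ᵥ N y) x) := by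
  have h : ⇑(d (fun y => T y *ᵥ N y) x) = (T x *ᵥ ·) ∘ d N x ∘ c.boost s x :=
    funext (hT.d_transform hN x)
  rw [h]
  exact (mulVec_injective_of_mul_transpose (hT.real_orth x)).comp
    (hi.comp (c.boost_injective hs x))

theorem isLelieuvreOn_d_transform {V : Set M} {f fμ : M → R3} (hf : IsLelieuvreOn c N V f)
    (hfμ : IsLelieuvreOn c (fun y => T y *ᵥ N y) V fμ) {x : M} (hx : x ∈ V)
    (X : TangentSpace 𝓘(ℝ, Plane) x) : d fμ x X = T x *ᵥ d f x (c.boost s x X) := by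
  rw [hfμ.eq x hx, hT.d_transform hN, mulVec_cross_mulVec (hT.real_orth x) (hT.real_det x),
    ← c.J_boost, hf.eq x hx]

theorem fderiv_transform_coordEndo (he : e ∈ IsManifold.maximalAtlas 𝓘(ℝ, Plane) ∞ M)
    {y : Plane} (hy : y ∈ e.target) (v : Plane) :
    fderiv ℝ ((fun x => T x *ᵥ N x) ∘ e.symm) y (coordEndo c.J e y v) = T (e.symm y) *ᵥ
      (((s + s⁻¹) / 2) • fderiv ℝ (N ∘ e.symm) y (coordEndo c.J e y v) +
        ((s - s⁻¹) / 2) • fderiv ℝ (N ∘ e.symm) y v) := by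
  rw [fderiv_comp_symm he hy ((hT.mulVec_smooth hN.smooth _).mdifferentiableAt (by simp)),
    chartFrame_coordEndo he c.J hy, hN.fderiv_chart_coordEndo he hy, hN.fderiv_chart he hy]
  refine (hT.d_transform hN _ _).trans ?_
  rw [c.boost_apply, c.J_sq, map_add, map_smul, map_smul]

theorem cross_fderiv_transform_coordEndo (he : e ∈ IsManifold.maximalAtlas 𝓘(ℝ, Plane) ∞ M)
    {y : Plane} (hy : y ∈ e.target) (v u : Plane) :
    (T (e.symm y) *ᵥ N (e.symm y)) ⨯₃
        fderiv ℝ (fun z => fderiv ℝ ((fun x => T x *ᵥ N x) ∘ e.symm) z (coordEndo c.J e z v)) y u =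
      T (e.symm y) *ᵥ (N (e.symm y) ⨯₃
        (((s + s⁻¹) / 2) • fderiv ℝ (fun z => fderiv ℝ (N ∘ e.symm) z (coordEndo c.J e z v)) y u +
          ((s - s⁻¹) / 2) • fderiv ℝ (fun z => fderiv ℝ (N ∘ e.symm) z v) y u)) := by
  have hJ : DifferentiableAt ℝ (fun z => fderiv ℝ (N ∘ e.symm) z (coordEndo c.J e z v)) y :=
    ((hN.contDiffOn_fderiv_coordEndo he v).contDiffAt
      (e.open_target.mem_nhds hy)).differentiableAt (by simp)
  have hv : DifferentiableAt ℝ (fun z => fderiv ℝ (N ∘ e.symm) z v) y :=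
    ((contDiffOn_fderiv_apply e.open_target (hN.contDiffOn_chart he) contDiffOn_const).contDiffAt
      (e.open_target.mem_nhds hy)).differentiableAt (by simp)
  rw [fderiv_congr_of_isOpen e.open_target
      (fun z hz => hT.fderiv_transform_coordEndo hN he hz v) hy,
    hT.mulVec_cross_fderiv_mulVec he hy
      ((hJ.fun_const_smul _).fun_add (hv.fun_const_smul _)) ?_,
    fderiv_fun_add (hJ.fun_const_smul _) (hv.fun_const_smul _), fderiv_fun_const_smul hJ,
    fderiv_fun_const_smul hv]
  · rfl
  · rw [dotProduct_add, dotProduct_smul, dotProduct_smul, hN.fderiv_chart he hy,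
      hN.fderiv_chart he hy, hN.dotProduct_d, hN.dotProduct_d, smul_zero, smul_zero, add_zero]

theorem isHarmonic_transform : IsHarmonic c (fun x => T x *ᵥ N x) where
  smooth := hT.mulVec_smooth hN.smooth
  unit x := by rw [mulVec_dotProduct_mulVec (hT.real_orth x), hN.unit]
  tension e he y hy := by
    have hsymm := fderiv_fderiv_apply_comm (((hN.contDiffOn_chart he).contDiffAt
      (e.open_target.mem_nhds hy)).of_le ENat.LEInfty.out) (0, 1) (1, 0)
    have htension := hN.tension e he y hy
    rw [dStarD, map_sub] at htension
    rw [dStarD, map_sub, hT.cross_fderiv_transform_coordEndo hN he hy,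
      hT.cross_fderiv_transform_coordEndo hN he hy, hsymm, ← Matrix.mulVec_sub, ← map_sub,
      add_sub_add_right_eq_sub, ← smul_sub, map_smul, map_sub, htension, smul_zero,
      Matrix.mulVec_zero]

end IsTrivialisingGauge

end Gauge

section Lelieuvre

variable {M : Type*} [TopologicalSpace M] [ChartedSpace Plane M]
  {c : LorentzConformalStructure M} {N f F : M → R3} {V : Set M}

/-! ### Lelieuvre's formula and K-surfaces -/

theorem IsLelieuvreOn.secondForm_eq_neg_areaForm (hf : IsLelieuvreOn c N V f) {x : M} (hx : x ∈ V)
    (X Y : TangentSpace 𝓘(ℝ, Plane) x) :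
    secondForm f N x X Y = -areaForm (N x) (d N x).toLinearMap (c.J x X) Y := by
  rw [secondForm, hf.eq x hx, areaForm_apply, dotProduct_comm, triple_product_permutation]
  rfl

namespace IsHarmonic

variable (hN : IsHarmonic c N)
include hN

theorem injective_d_of_isLelieuvreOn (hf : IsLelieuvreOn c N V f) {x : M} (hx : x ∈ V)
    (hi : Function.Injective (d N x)) : Function.Injective (d f x) := by
  refine (injective_iff_map_eq_zero _).mpr fun X hX => ?_
  rw [hf.eq x hx] at hX
  have h := cross_cross_of_dotProduct_eq_zero (hN.unit x) (hN.dotProduct_d x (c.J x X))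
  rw [hX, map_zero, zero_eq_neg, map_eq_zero_iff _ hi] at h
  rw [← c.J_sq x X, h, map_zero]

theorem hasGaussCurvatureAt (hf : IsLelieuvreOn c N V f) {x : M} (hx : x ∈ V)
    (hi : Function.Injective (d N x)) : HasGaussCurvatureAt f N x (-1) := by
  obtain ⟨R, hR, hdet⟩ := exists_rightAngle_rotation (D := (d N x).toLinearMap) (tangentBasis x)
    (hN.unit x) (hN.dotProduct_d x) hi
  refine ⟨(c.J x).toLinearMap ∘ₗ R, fun X => ?_, ?_⟩
  · refine (hf.eq x hx _).trans ?_
    rw [LinearMap.comp_apply, ContinuousLinearMap.coe_coe, c.J_sq]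
    refine (congrArg _ (hR X)).trans ?_
    exact cross_cross_of_dotProduct_eq_zero (hN.unit x) (hN.dotProduct_d x X)
  · rw [LinearMap.det_comp, hdet, c.det_J, mul_one]

theorem isKSurfaceOn (hf : IsLelieuvreOn c N V f) (hi : ∀ x ∈ V, Function.Injective (d N x)) :
    IsKSurfaceOn V f N (-1) where
  neg := neg_one_lt_zero
  immersed :=
    { smooth := hf.smooth
      smooth_gauss := hN.smooth.contMDiffOn
      immersion := fun x hx => hN.injective_d_of_isLelieuvreOn hf hx (hi x hx)
      unit := fun x _ => hN.unit x
      normal := fun x hx X => by rw [hf.eq x hx, dot_self_cross] }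
  curvature := fun x hx => hN.hasGaussCurvatureAt hf hx (hi x hx)

theorem secondForm_conformal (hf : IsLelieuvreOn c N V f) {x : M} (hx : x ∈ V)
    (hi : Function.Injective (d N x)) :
    ∃ t : ℝ, t ≠ 0 ∧ ∀ X Y, secondForm f N x X Y = t * c.g x X Y := by
  obtain ⟨w, hw⟩ := c.exists_J_left_eq_g_smul (x := x)
    (isAlt_areaForm (n := N x) (D := (d N x).toLinearMap))
  refine ⟨-w, neg_ne_zero.mpr ?_, fun X Y => ?_⟩
  · rintro rfl
    refine areaForm_ne_zero (tangentBasis x) (hN.unit x) (hN.dotProduct_d x) hi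
      (LinearMap.ext₂ fun X Y => ?_)
    rw [← c.J_sq x X, hw, smul_zero]
    rfl
  · rw [hf.secondForm_eq_neg_areaForm hx, hw, smul_eq_mul, neg_mul, mul_comm]

end IsHarmonic

theorem IsLelieuvreOn.eq_add_const [IsManifold 𝓘(ℝ, Plane) ∞ M] (hV : IsOpen V)
    (hVc : IsPreconnected V) (hf : IsLelieuvreOn c N V f) (hF : IsLelieuvreOn c N V F) :
    ∃ v : R3, ∀ x ∈ V, f x = F x + v := by
  rcases V.eq_empty_or_nonempty with rfl | ⟨p, hp⟩
  · exact ⟨0, fun x hx => hx.elim⟩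
  have hdf := hf.smooth.mdifferentiableOn (by simp)
  have hdF := hF.smooth.mdifferentiableOn (by simp)
  have h0 : ∀ x ∈ V, mfderiv 𝓘(ℝ, Plane) 𝓘(ℝ, R3) (f - F) x = 0 := fun x hx => by
    have hsub := ((hdf x hx).mdifferentiableAt (hV.mem_nhds hx)).hasMFDerivAt.sub
      ((hdF x hx).mdifferentiableAt (hV.mem_nhds hx)).hasMFDerivAt
    refine hsub.mfderiv.trans (ContinuousLinearMap.ext fun X => ?_)
    exact sub_eq_zero.mpr ((hf.eq x hx X).trans (hF.eq x hx X).symm)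
  refine ⟨f p - F p, fun x hx => ?_⟩
  have h : f x - F x = f p - F p := eq_of_mfderiv_eq_zero hV hVc (hdf.sub hdF) h0 hx hp
  rw [← h, add_sub_cancel]

/-! ### Surfaces in a chart -/

section Pullback

variable {e : OpenPartialHomeomorph M Plane} {y : Plane} {K : ℝ}

theorem d_comp_symm (he : e ∈ IsManifold.maximalAtlas 𝓘(ℝ, Plane) ∞ M) (hy : y ∈ e.target)
    (hf : MDifferentiableAt 𝓘(ℝ, Plane) 𝓘(ℝ, R3) f (e.symm y)) (v : Plane) :
    d (f ∘ e.symm) y v = d f (e.symm y) (chartFrame e y v) :=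
  mfderiv_comp_apply y hf
    ((mdifferentiable_of_mem_maximalAtlas he).mdifferentiableAt_symm hy) v

theorem HasGaussCurvatureAt.comp_symm (he : e ∈ IsManifold.maximalAtlas 𝓘(ℝ, Plane) ∞ M)
    (hy : y ∈ e.target) (hf : MDifferentiableAt 𝓘(ℝ, Plane) 𝓘(ℝ, R3) f (e.symm y))
    (hN : MDifferentiableAt 𝓘(ℝ, Plane) 𝓘(ℝ, R3) N (e.symm y))
    (h : HasGaussCurvatureAt f N (e.symm y) K) :
    HasGaussCurvatureAt (f ∘ e.symm) (N ∘ e.symm) y K := by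
  obtain ⟨S, hS, hdet⟩ := h
  let φ : Plane ≃ₗ[ℝ] TangentSpace 𝓘(ℝ, Plane) (e.symm y) :=
    .ofBijective (chartFrame e y).toLinearMap (chartFrame_bijective he hy)
  refine ⟨φ.symm.conj S, fun v => ?_, (LinearMap.det_conj S φ.symm).trans hdet⟩
  have hSv : chartFrame e y (φ.symm.conj S v) = S (chartFrame e y v) := φ.apply_symm_apply _
  calc d (f ∘ e.symm) y (φ.symm.conj S v)
      = d f (e.symm y) (S (chartFrame e y v)) := (d_comp_symm he hy hf _).trans (congrArg _ hSv)
    _ = -d (N ∘ e.symm) y v := (hS _).trans (congrArg _ (d_comp_symm he hy hN v).symm)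

theorem IsKSurfaceOn.comp_symm (he : e ∈ IsManifold.maximalAtlas 𝓘(ℝ, Plane) ∞ M)
    (hV : IsOpen V) (heV : e.source ⊆ V) (h : IsKSurfaceOn V f N K) :
    IsKSurfaceOn e.target (f ∘ e.symm) (N ∘ e.symm) K := by
  have hmem (y : Plane) (hy : y ∈ e.target) : e.symm y ∈ V := heV (e.map_target hy)
  have hdiff {g : M → R3} (hg : ContMDiffOn 𝓘(ℝ, Plane) 𝓘(ℝ, R3) ∞ g V) (y : Plane)
      (hy : y ∈ e.target) : MDifferentiableAt 𝓘(ℝ, Plane) 𝓘(ℝ, R3) g (e.symm y) :=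
    (hg.contMDiffAt (hV.mem_nhds (hmem y hy))).mdifferentiableAt (by simp)
  have hdf (y : Plane) (hy : y ∈ e.target) := d_comp_symm he hy (hdiff h.immersed.smooth y hy)
  exact
    { neg := h.neg
      immersed :=
        { smooth := (contDiffOn_comp_symm he h.immersed.smooth heV).contMDiffOn
          smooth_gauss := (contDiffOn_comp_symm he h.immersed.smooth_gauss heV).contMDiffOn
          immersion := fun y hy => by
            rw [show ⇑(d (f ∘ e.symm) y) = d f (e.symm y) ∘ chartFrame e y from
              funext (hdf y hy)]
            exact (h.immersed.immersion _ (hmem y hy)).comp (chartFrame_bijective he hy).injective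
          unit := fun y hy => h.immersed.unit _ (hmem y hy)
          normal := fun y hy v =>
            (congrArg _ (hdf y hy v)).trans (h.immersed.normal _ (hmem y hy) _) }
      curvature := fun y hy => (h.curvature _ (hmem y hy)).comp_symm he hy
        (hdiff h.immersed.smooth y hy) (hdiff h.immersed.smooth_gauss y hy) }

end Pullback

end Lelieuvre

section LocalExistence

variable {M : Type*} [TopologicalSpace M] [ChartedSpace Plane M]
  {c : LorentzConformalStructure M} {N : M → R3} {e : OpenPartialHomeomorph M Plane} {y : Plane}

/-- The 1-form `N × *dN` in the chart `e`. -/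
noncomputable def lelieuvreForm (c : LorentzConformalStructure M) (N : M → R3)
    (e : OpenPartialHomeomorph M Plane) (y : Plane) : Plane →L[ℝ] R3 :=
  (crossProduct (N (e.symm y))).toContinuousLinearMap.comp
    ((fderiv ℝ (N ∘ e.symm) y).comp (coordEndo c.J e y))

namespace IsHarmonic

variable (hN : IsHarmonic c N)
include hN

theorem contDiffOn_lelieuvreForm (he : e ∈ IsManifold.maximalAtlas 𝓘(ℝ, Plane) ∞ M) :
    ContDiffOn ℝ ∞ (lelieuvreForm c N e) e.target :=
  contDiffOn_clm_apply.mpr fun v => contDiffOn_bilinear_apply crossProduct (hN.contDiffOn_chart he)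
    (hN.contDiffOn_fderiv_coordEndo he v)

theorem fderiv_lelieuvreForm_apply (he : e ∈ IsManifold.maximalAtlas 𝓘(ℝ, Plane) ∞ M)
    (hy : y ∈ e.target) (v w : Plane) :
    fderiv ℝ (lelieuvreForm c N e) y v w =
      d N (e.symm y) (chartFrame e y v) ⨯₃
          d N (e.symm y) (c.J (e.symm y) (chartFrame e y w)) +
        N (e.symm y) ⨯₃
          fderiv ℝ (fun z => fderiv ℝ (N ∘ e.symm) z (coordEndo c.J e z w)) y v := by
  have hdiff {G : Type} [NormedAddCommGroup G] [NormedSpace ℝ G] {g : Plane → G}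
      (hg : ContDiffOn ℝ ∞ g e.target) : DifferentiableAt ℝ g y :=
    (hg.contDiffAt (e.open_target.mem_nhds hy)).differentiableAt (by simp)
  have heval : fderiv ℝ (fun z => lelieuvreForm c N e z w) y v =
      fderiv ℝ (lelieuvreForm c N e) y v w := by
    rw [fderiv_clm_apply (hdiff (hN.contDiffOn_lelieuvreForm he)) (differentiableAt_const w)]
    simp
  rw [← heval, ← hN.fderiv_chart he hy, ← hN.fderiv_chart_coordEndo he hy]
  exact fderiv_cross (hdiff (hN.contDiffOn_chart he))
    (hdiff (hN.contDiffOn_fderiv_coordEndo he w)) v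

theorem fderiv_lelieuvreForm_comm (he : e ∈ IsManifold.maximalAtlas 𝓘(ℝ, Plane) ∞ M)
    (hy : y ∈ e.target) (v w : Plane) :
    fderiv ℝ (lelieuvreForm c N e) y v w = fderiv ℝ (lelieuvreForm c N e) y w v := by
  have hAlt : (crossProduct.compl₁₂ (d N (e.symm y)).toLinearMap
      (d N (e.symm y)).toLinearMap).IsAlt := fun X => cross_self _
  have hJ := c.apply_J_left_of_isAlt hAlt (chartFrame e y (1, 0)) (chartFrame e y (0, 1))
  have htension := hN.tension e he y hy
  rw [dStarD, map_sub] at htension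
  have hbasis : fderiv ℝ (lelieuvreForm c N e) y (1, 0) (0, 1) =
      fderiv ℝ (lelieuvreForm c N e) y (0, 1) (1, 0) := by
    rw [hN.fderiv_lelieuvreForm_apply he hy, hN.fderiv_lelieuvreForm_apply he hy,
      sub_eq_zero.mp htension]
    exact congrArg (· + _) ((neg_eq_iff_eq_neg.mpr hJ).symm.trans (cross_anticomm _ _))
  exact map_comm_of_basis (B := (fderiv ℝ (lelieuvreForm c N e) y).toLinearMap₁₂)
    (Module.Basis.finTwoProd ℝ) (by simpa using hbasis) v w

theorem isLelieuvreOn_comp (he : e ∈ IsManifold.maximalAtlas 𝓘(ℝ, Plane) ∞ M) {s : Set Plane}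
    (hs : IsOpen s) {f : Plane → R3} (hf : ContDiffOn ℝ ∞ f s)
    (hfd : ∀ y ∈ s, fderiv ℝ f y = lelieuvreForm c N e y) :
    IsLelieuvreOn c N (e.source ∩ e ⁻¹' s) (f ∘ e) where
  smooth := hf.contMDiffOn.comp
    ((contMDiffOn_of_mem_maximalAtlas he).mono Set.inter_subset_left) fun _ hp => hp.2
  eq := by
    rintro p ⟨hp, hps⟩ X
    obtain ⟨y, hy, rfl⟩ : ∃ y ∈ e.target, e.symm y = p := ⟨e p, e.map_source hp, e.left_inv hp⟩
    rw [Set.mem_preimage, e.right_inv hy] at hps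
    have hchain : d (f ∘ e) (e.symm y) X = fderiv ℝ f (e (e.symm y))
        (mfderiv 𝓘(ℝ, Plane) 𝓘(ℝ, Plane) e (e.symm y) X) := by
      rw [← mfderiv_eq_fderiv]
      refine mfderiv_comp_apply _ ?_
        ((mdifferentiable_of_mem_maximalAtlas he).mdifferentiableAt hp) X
      rw [e.right_inv hy]
      exact ((hf.contDiffAt (hs.mem_nhds hps)).differentiableAt (by simp)).mdifferentiableAt
    rw [hchain, e.right_inv hy, hfd y hps]
    refine congrArg (N (e.symm y) ⨯₃ ·) ((hN.fderiv_chart_coordEndo he hy _).trans ?_)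
    exact congrArg (fun Z => d N _ (c.J _ Z)) (chartFrame_mfderiv he hy X)

theorem exists_lelieuvre [IsManifold 𝓘(ℝ, Plane) ∞ M] (x : M) :
    ∃ V : Set M, IsOpen V ∧ x ∈ V ∧ ∃ f : M → R3, IsLelieuvreOn c N V f := by
  obtain ⟨e, he, y, hy, rfl⟩ := exists_mem_maximalAtlas_symm_eq (E := Plane) x
  obtain ⟨r, hr, hball⟩ := Metric.isOpen_iff.mp e.open_target y hy
  obtain ⟨f, hf, hfd⟩ := exists_contDiffOn_primitive Metric.isOpen_ball (convex_ball y r)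
    ((hN.contDiffOn_lelieuvreForm he).mono hball)
    fun z hz => hN.fderiv_lelieuvreForm_comm he (hball hz)
  refine ⟨_, e.isOpen_inter_preimage Metric.isOpen_ball, ⟨e.map_target hy, ?_⟩, f ∘ e,
    hN.isLelieuvreOn_comp he Metric.isOpen_ball hf hfd⟩
  rw [Set.mem_preimage, e.right_inv hy]
  exact Metric.mem_ball_self hr

end IsHarmonic

end LocalExistence

/-! ### The sine-Gordon equation of a spherical net -/

/-- A harmonic map `n` of an open set of the plane to the sphere, written in null coordinates
`(ξ, η)` in which `|n_ξ| = |n_η| = 1`, the angle between `n_ξ` and `-n_η` being `om`. It is the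
Gauss map of a `K`-surface in Tchebyshev coordinates. -/
structure IsSphericalNetOn (U : Set Plane) (n : Plane → R3) (om : Plane → ℝ) : Prop where
  isOpen : IsOpen U
  smooth : ContDiffOn ℝ ∞ n U
  smooth_angle : ContDiffOn ℝ ∞ om U
  unit : ∀ y ∈ U, n y ⬝ᵥ n y = 1
  unit_fst : ∀ y ∈ U, fderiv ℝ n y (1, 0) ⬝ᵥ fderiv ℝ n y (1, 0) = 1
  unit_snd : ∀ y ∈ U, fderiv ℝ n y (0, 1) ⬝ᵥ fderiv ℝ n y (0, 1) = 1
  angle : ∀ y ∈ U, fderiv ℝ n y (1, 0) ⬝ᵥ fderiv ℝ n y (0, 1) = -Real.cos (om y)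
  tension : ∀ y ∈ U, n y ⨯₃ fderiv ℝ (fun z => fderiv ℝ n z (1, 0)) y (0, 1) = 0

/-- The geodesic curvature `n_ξξ · (n × n_ξ)` of the `ξ`-lines of a spherical net. -/
noncomputable def fstCurvature (n : Plane → R3) (y : Plane) : ℝ :=
  fderiv ℝ (fun z => fderiv ℝ n z (1, 0)) y (1, 0) ⬝ᵥ (n y ⨯₃ fderiv ℝ n y (1, 0))

/-- The density `n · (n_ξ × n_η)` of the pull-back of the area form of the sphere by `n`. -/
noncomputable def areaDensity (n : Plane → R3) (y : Plane) : ℝ :=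
  n y ⬝ᵥ fderiv ℝ n y (1, 0) ⨯₃ fderiv ℝ n y (0, 1)

theorem dotProduct_fderiv_eq_zero {E m : Type*} [NormedAddCommGroup E] [NormedSpace ℝ E] [Fintype m]
    {f : E → m → ℝ} {U : Set E} (hU : IsOpen U) (hf : DifferentiableOn ℝ f U) {r : ℝ}
    (h : ∀ y ∈ U, f y ⬝ᵥ f y = r) {y : E} (hy : y ∈ U) (v : E) : f y ⬝ᵥ fderiv ℝ f y v = 0 := by
  rw [← mfderiv_eq_fderiv]
  exact dotProduct_mfderiv_eq_zero (hf.differentiableAt (hU.mem_nhds hy)).mdifferentiableAt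
    (Filter.eventually_of_mem (hU.mem_nhds hy) h) v

namespace IsSphericalNetOn

variable {U : Set Plane} {n : Plane → R3} {om : Plane → ℝ} {y : Plane}

theorem contDiffOn_fderiv (h : IsSphericalNetOn U n om) (v : Plane) :
    ContDiffOn ℝ ∞ (fun z => fderiv ℝ n z v) U :=
  contDiffOn_fderiv_apply h.isOpen h.smooth contDiffOn_const

theorem differentiableAt (h : IsSphericalNetOn U n om) {F : Type*} [NormedAddCommGroup F]
    [NormedSpace ℝ F] {g : Plane → F} (hg : ContDiffOn ℝ ∞ g U) (hy : y ∈ U) :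
    DifferentiableAt ℝ g y :=
  (hg.contDiffAt (h.isOpen.mem_nhds hy)).differentiableAt (by simp)

theorem dotProduct_fderiv (h : IsSphericalNetOn U n om) (hy : y ∈ U) (v : Plane) :
    n y ⬝ᵥ fderiv ℝ n y v = 0 :=
  dotProduct_fderiv_eq_zero h.isOpen (h.smooth.differentiableOn (by simp)) h.unit hy v

theorem dotProduct_fderiv_fderiv (h : IsSphericalNetOn U n om) (hy : y ∈ U) (v w : Plane) :
    n y ⬝ᵥ fderiv ℝ (fun z => fderiv ℝ n z v) y w = -(fderiv ℝ n y v ⬝ᵥ fderiv ℝ n y w) := by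
  have h2 := fderiv_dotProduct (h.differentiableAt h.smooth hy)
    (h.differentiableAt (h.contDiffOn_fderiv v) hy) w
  rw [fderiv_congr_of_isOpen h.isOpen (fun z hz => h.dotProduct_fderiv hz v) hy, fderiv_const_apply,
    zero_apply, dotProduct_comm (fderiv ℝ n y w)] at h2
  linarith

theorem mixed_derivative (h : IsSphericalNetOn U n om) (hy : y ∈ U) :
    fderiv ℝ (fun z => fderiv ℝ n z (1, 0)) y (0, 1) = Real.cos (om y) • n y := by
  rw [eq_dotProduct_smul_of_cross_eq_zero (h.unit y hy) (h.tension y hy),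
    h.dotProduct_fderiv_fderiv hy, h.angle y hy, neg_neg]

theorem mixed_derivative_symm (h : IsSphericalNetOn U n om) (hy : y ∈ U) :
    fderiv ℝ (fun z => fderiv ℝ n z (0, 1)) y (1, 0) = Real.cos (om y) • n y := by
  rw [← h.mixed_derivative hy]
  exact fderiv_fderiv_apply_comm
    ((h.smooth.contDiffAt (h.isOpen.mem_nhds hy)).of_le ENat.LEInfty.out) _ _

theorem cross_fderiv (h : IsSphericalNetOn U n om) (hy : y ∈ U) :
    fderiv ℝ n y (1, 0) ⨯₃ fderiv ℝ n y (0, 1) = areaDensity n y • n y :=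
  cross_eq_tripleProduct_smul (h.unit y hy) (h.dotProduct_fderiv hy _) (h.dotProduct_fderiv hy _)

theorem areaDensity_sq (h : IsSphericalNetOn U n om) (hy : y ∈ U) :
    areaDensity n y ^ 2 = Real.sin (om y) ^ 2 := by
  have hW := cross_dot_cross (fderiv ℝ n y (1, 0)) (fderiv ℝ n y (0, 1)) (fderiv ℝ n y (1, 0))
    (fderiv ℝ n y (0, 1))
  rw [h.cross_fderiv hy, dotProduct_comm (fderiv ℝ n y (0, 1)) (fderiv ℝ n y (1, 0)),
    h.unit_fst y hy, h.unit_snd y hy, h.angle y hy] at hW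
  simp only [smul_dotProduct, dotProduct_smul, h.unit y hy, smul_eq_mul] at hW
  rw [Real.sin_sq]
  linear_combination hW

theorem sin_ne_zero (h : IsSphericalNetOn U n om) (hy : y ∈ U)
    (hi : Function.Injective (fderiv ℝ n y)) : Real.sin (om y) ≠ 0 := by
  intro h0
  have hexp : fderiv ℝ n y (1, Real.cos (om y)) =
      fderiv ℝ n y (1, 0) + Real.cos (om y) • fderiv ℝ n y (0, 1) := by
    rw [← map_smul, ← map_add]
    simp
  have hz : fderiv ℝ n y (1, Real.cos (om y)) ⬝ᵥ fderiv ℝ n y (1, Real.cos (om y)) =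
      Real.sin (om y) ^ 2 := by
    rw [hexp, Real.sin_sq]
    simp only [dotProduct_add, add_dotProduct, smul_dotProduct, dotProduct_smul, smul_eq_mul,
      dotProduct_comm (fderiv ℝ n y (0, 1)) (fderiv ℝ n y (1, 0)), h.unit_fst y hy, h.unit_snd y hy,
      h.angle y hy]
    ring
  rw [h0, zero_pow two_ne_zero, dotProduct_self_eq_zero, ← map_zero (fderiv ℝ n y)] at hz
  exact one_ne_zero (congrArg Prod.fst (hi hz))

theorem contDiffOn_fstCurvature (h : IsSphericalNetOn U n om) :
    ContDiffOn ℝ ∞ (fstCurvature n) U :=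
  contDiffOn_bilinear_apply (dotProductBilin ℝ ℝ)
    (contDiffOn_fderiv_apply h.isOpen (h.contDiffOn_fderiv _) contDiffOn_const)
    (contDiffOn_bilinear_apply crossProduct h.smooth (h.contDiffOn_fderiv _))

theorem contDiffOn_areaDensity (h : IsSphericalNetOn U n om) : ContDiffOn ℝ ∞ (areaDensity n) U :=
  contDiffOn_bilinear_apply (dotProductBilin ℝ ℝ) h.smooth
    (contDiffOn_bilinear_apply crossProduct (h.contDiffOn_fderiv _) (h.contDiffOn_fderiv _))

theorem fderiv_fderiv_fst_fst (h : IsSphericalNetOn U n om) (hy : y ∈ U) :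
    fderiv ℝ (fun z => fderiv ℝ n z (1, 0)) y (1, 0) =
      fstCurvature n y • (n y ⨯₃ fderiv ℝ n y (1, 0)) - n y := by
  set a := fderiv ℝ n y (1, 0)
  set p := fderiv ℝ (fun z => fderiv ℝ n z (1, 0)) y (1, 0) with hp
  have hnp : n y ⬝ᵥ p = -1 := by rw [hp, h.dotProduct_fderiv_fderiv hy, h.unit_fst y hy]
  have hap : a ⬝ᵥ p = 0 :=
    dotProduct_fderiv_eq_zero h.isOpen ((h.contDiffOn_fderiv _).differentiableOn (by simp))
      h.unit_fst hy _
  have han : a ⬝ᵥ n y = 0 := (dotProduct_comm _ _).trans (h.dotProduct_fderiv hy _)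
  have hunit : (n y ⨯₃ a) ⬝ᵥ (n y ⨯₃ a) = 1 := by
    rw [cross_dotProduct_cross_of_dotProduct_eq_zero (h.unit y hy) (h.dotProduct_fderiv hy _),
      h.unit_fst y hy]
  have hcross : (n y ⨯₃ a) ⨯₃ (p + n y) = 0 := by
    rw [cross_cross_eq_smul_sub_smul, dotProduct_add, dotProduct_add, hnp, hap, han, h.unit y hy]
    simp
  have hk : (n y ⨯₃ a) ⬝ᵥ (p + n y) = fstCurvature n y := by
    rw [dotProduct_add, dotProduct_comm _ (n y), dot_self_cross, add_zero, dotProduct_comm]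
    rfl
  rw [← hk, ← eq_dotProduct_smul_of_cross_eq_zero hunit hcross, add_sub_cancel_right]

theorem fderiv_fstCurvature_snd (h : IsSphericalNetOn U n om) (hy : y ∈ U) :
    fderiv ℝ (fstCurvature n) y (0, 1) = areaDensity n y := by
  have dn := h.differentiableAt h.smooth hy
  have da := h.differentiableAt (h.contDiffOn_fderiv (1, 0)) hy
  have dp := h.differentiableAt (contDiffOn_fderiv_apply h.isOpen (h.contDiffOn_fderiv (1, 0))
    (contDiffOn_const (c := ((1, 0) : Plane)))) hy
  have hc := h.differentiableAt
    (contDiffOn_bilinear_apply crossProduct h.smooth (h.contDiffOn_fderiv (1, 0))) hy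
  have hthird : fderiv ℝ (fun z => fderiv ℝ (fun w => fderiv ℝ n w (1, 0)) z (1, 0)) y (0, 1) =
      Real.cos (om y) • fderiv ℝ n y (1, 0) +
        fderiv ℝ (fun z => Real.cos (om z)) y (1, 0) • n y := by
    rw [fderiv_fderiv_apply_comm (((h.contDiffOn_fderiv (1, 0)).contDiffAt
        (h.isOpen.mem_nhds hy)).of_le ENat.LEInfty.out),
      fderiv_congr_of_isOpen h.isOpen (fun z hz => h.mixed_derivative hz) hy,
      fderiv_fun_smul (h.differentiableAt h.smooth_angle hy).cos dn]
    rfl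
  have hthird_dot : fderiv ℝ (fun z => fderiv ℝ (fun w => fderiv ℝ n w (1, 0)) z (1, 0)) y (0, 1) ⬝ᵥ
      (n y ⨯₃ fderiv ℝ n y (1, 0)) = 0 := by
    rw [hthird, add_dotProduct, smul_dotProduct, smul_dotProduct, dot_cross_self, dot_self_cross,
      smul_zero, smul_zero, add_zero]
  have hnormal : fderiv ℝ (fun z => n z ⨯₃ fderiv ℝ n z (1, 0)) y (0, 1) =
      -(areaDensity n y • n y) := by
    rw [fderiv_cross dn da, h.mixed_derivative hy, map_smul, cross_self, smul_zero, add_zero,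
      ← cross_anticomm, h.cross_fderiv hy]
  refine (fderiv_dotProduct dp hc _).trans ?_
  rw [hthird_dot, hnormal, zero_add, dotProduct_neg, dotProduct_smul, dotProduct_comm,
    h.dotProduct_fderiv_fderiv hy, h.unit_fst y hy, smul_eq_mul]
  ring

theorem sin_mul_fderiv_angle_fst (h : IsSphericalNetOn U n om) (hy : y ∈ U) :
    Real.sin (om y) * fderiv ℝ om y (1, 0) = fstCurvature n y * areaDensity n y := by
  have hd := fderiv_dotProduct (h.differentiableAt (h.contDiffOn_fderiv (1, 0)) hy)
    (h.differentiableAt (h.contDiffOn_fderiv (0, 1)) hy) (1, 0)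
  rw [fderiv_congr_of_isOpen h.isOpen h.angle hy, fderiv_fun_neg,
    fderiv_cos (h.differentiableAt h.smooth_angle hy), h.mixed_derivative_symm hy, dotProduct_smul,
    dotProduct_comm (fderiv ℝ n y (1, 0)), h.dotProduct_fderiv hy, h.fderiv_fderiv_fst_fst hy,
    sub_dotProduct, h.dotProduct_fderiv hy, smul_dotProduct, dotProduct_comm (_ ⨯₃ _),
    triple_product_permutation] at hd
  simpa [areaDensity] using hd

theorem areaDensity_mul_fderiv (h : IsSphericalNetOn U n om) (hy : y ∈ U) (v : Plane) :
    areaDensity n y * fderiv ℝ (areaDensity n) y v =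
      Real.sin (om y) * Real.cos (om y) * fderiv ℝ om y v := by
  have hom := h.differentiableAt h.smooth_angle hy
  have hW := h.differentiableAt h.contDiffOn_areaDensity hy
  have hd := congrArg (· v) (fderiv_congr_of_isOpen h.isOpen (fun z hz => h.areaDensity_sq hz) hy)
  rw [fderiv_fun_pow _ hW, fderiv_fun_pow _ hom.sin, fderiv_sin hom] at hd
  simp only [smul_apply, smul_eq_mul, nsmul_eq_mul] at hd
  norm_num at hd
  linear_combination hd / 2

theorem sineGordonOn (h : IsSphericalNetOn U n om)
    (hi : ∀ y ∈ U, Function.Injective (fderiv ℝ n y)) : SineGordonOn U (-1) om := by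
  refine ⟨h.smooth_angle, fun y hy => ?_⟩
  have hom := h.differentiableAt h.smooth_angle hy
  have homx := h.differentiableAt
    (contDiffOn_fderiv_apply h.isOpen h.smooth_angle (contDiffOn_const (c := ((1, 0) : Plane)))) hy
  have hd : fderiv ℝ (fun z => Real.sin (om z) * fderiv ℝ om z (1, 0)) y (0, 1) =
      fderiv ℝ (fun z => fstCurvature n z * areaDensity n z) y (0, 1) := by
    rw [fderiv_congr_of_isOpen h.isOpen (fun z hz => h.sin_mul_fderiv_angle_fst hz) hy]
  rw [fderiv_fun_mul hom.sin homx, fderiv_fun_mul (h.differentiableAt h.contDiffOn_fstCurvature hy)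
    (h.differentiableAt h.contDiffOn_areaDensity hy), fderiv_sin hom] at hd
  simp only [add_apply, smul_apply, smul_eq_mul, h.fderiv_fstCurvature_snd hy] at hd
  apply mul_left_cancel₀ (pow_ne_zero 3 (h.sin_ne_zero hy (hi y hy)))
  -- Multiply the `η`-derivative of `sin ω ω_ξ = kW` by `sin² ω` and eliminate `W²`, `W W_η`, `kW`.
  linear_combination Real.sin (om y) ^ 2 * hd
    + (Real.sin (om y) ^ 2 - fstCurvature n y * fderiv ℝ (areaDensity n) y (0, 1)) *
      h.areaDensity_sq hy
    - Real.sin (om y) * Real.cos (om y) * fderiv ℝ om y (0, 1) * h.sin_mul_fderiv_angle_fst hy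
    + fstCurvature n y * areaDensity n y * h.areaDensity_mul_fderiv hy (0, 1)

end IsSphericalNetOn

/-! ### Tchebyshev coordinates and Lie transforms -/

section FirstForm

variable {U : Set Plane} {f : Plane → R3} {A B : ℝ} {om : Plane → ℝ}

theorem d_eq_fderiv (f : Plane → R3) (y v : Plane) : d f y v = fderiv ℝ f y v := by
  rw [d, mfderiv_eq_fderiv]; rfl

theorem firstForm_apply (f : Plane → R3) (y : Plane) (a b : ℝ) :
    firstForm f y (a, b) (a, b) =
      (fderiv ℝ f y (1, 0) ⬝ᵥ fderiv ℝ f y (1, 0)) * a ^ 2 +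
        2 * (fderiv ℝ f y (1, 0) ⬝ᵥ fderiv ℝ f y (0, 1)) * a * b +
        (fderiv ℝ f y (0, 1) ⬝ᵥ fderiv ℝ f y (0, 1)) * b ^ 2 := by
  have h : d f y (a, b) = a • fderiv ℝ f y (1, 0) + b • fderiv ℝ f y (0, 1) := by
    rw [← map_smul, ← map_smul, ← map_add]
    simpa using d_eq_fderiv f y (a, b)
  change d f y (a, b) ⬝ᵥ d f y (a, b) = _
  rw [h]
  simp only [dotProduct_add, add_dotProduct, smul_dotProduct, dotProduct_smul, smul_eq_mul,
    dotProduct_comm (fderiv ℝ f y (0, 1)) (fderiv ℝ f y (1, 0))]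
  ring

theorem hasFirstFormOn_iff :
    HasFirstFormOn U f A om B ↔ ∀ y ∈ U,
      fderiv ℝ f y (1, 0) ⬝ᵥ fderiv ℝ f y (1, 0) = A ∧
      fderiv ℝ f y (1, 0) ⬝ᵥ fderiv ℝ f y (0, 1) = Real.cos (om y) ∧
      fderiv ℝ f y (0, 1) ⬝ᵥ fderiv ℝ f y (0, 1) = B := by
  simp only [HasFirstFormOn, firstForm_apply]
  refine forall₂_congr fun y _ => ⟨fun h => ?_, fun ⟨h1, h2, h3⟩ a b => by rw [h1, h2, h3]⟩
  have h1 := h 1 0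
  have h2 := h 0 1
  have h3 := h 1 1
  refine ⟨?_, ?_, ?_⟩ <;> linarith

/-- The rescaling `lieScale μ` of the plane, as a linear isomorphism. -/
noncomputable def lieScaleEquiv {μ : ℝ} (hμ : μ ≠ 0) : Plane ≃L[ℝ] Plane :=
  (ContinuousLinearEquiv.smulLeft (Units.mk0 μ hμ)⁻¹).prodCongr
    (ContinuousLinearEquiv.smulLeft (Units.mk0 μ hμ))

theorem lieScale_fst (μ : ℝ) : lieScale μ (1, 0) = μ⁻¹ • (1, 0) := by simp [lieScale]

theorem lieScale_snd (μ : ℝ) : lieScale μ (0, 1) = μ • (0, 1) := by simp [lieScale]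

theorem HasFirstFormOn.comp_lieScale {μ : ℝ} (hμ : μ ≠ 0) (h : HasFirstFormOn U f A om B) :
    HasFirstFormOn (lieScale μ ⁻¹' U) (f ∘ lieScale μ) (μ⁻¹ ^ 2 * A) (om ∘ lieScale μ)
      (μ ^ 2 * B) := by
  rw [hasFirstFormOn_iff] at h ⊢
  intro y hy
  obtain ⟨h1, h2, h3⟩ := h _ hy
  have hd (v : Plane) :
      fderiv ℝ (f ∘ lieScale μ) y v = fderiv ℝ f (lieScale μ y) (lieScale μ v) :=
    DFunLike.congr_fun (lieScaleEquiv hμ).comp_right_fderiv v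
  simp only [hd, lieScale_fst, lieScale_snd, map_smul, smul_dotProduct, dotProduct_smul, h1, h2, h3,
    smul_eq_mul]
  refine ⟨by ring, ?_, by ring⟩
  rw [mul_inv_cancel_left₀ hμ]
  rfl

end FirstForm

section RescaledChart

variable {X : Type*} [TopologicalSpace X] {e : OpenPartialHomeomorph X Plane} {μ : ℝ}

/-- The chart `(μ ξ, μ⁻¹ η)`, where `e = (ξ, η)`. -/
noncomputable def rescaledChart (e : OpenPartialHomeomorph X Plane) (hμ : μ ≠ 0) :
    OpenPartialHomeomorph X Plane :=
  e.transHomeomorph (lieScaleEquiv hμ).symm.toHomeomorph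

end RescaledChart

section LieTransform

variable {M : Type*} [TopologicalSpace M] [ChartedSpace Plane M]
  {c : LorentzConformalStructure M} {N f : M → R3} {V W : Set M}
  {e : OpenPartialHomeomorph M Plane} {μ : ℝ}

theorem IsLelieuvreOn.mono (hf : IsLelieuvreOn c N V f) (hWV : W ⊆ V) : IsLelieuvreOn c N W f :=
  ⟨hf.smooth.mono hWV, fun x hx => hf.eq x (hWV hx)⟩

theorem IsLelieuvreOn.mdifferentiableAt (hf : IsLelieuvreOn c N V f) (hV : IsOpen V) {x : M}
    (hx : x ∈ V) : MDifferentiableAt 𝓘(ℝ, Plane) 𝓘(ℝ, R3) f x :=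
  (hf.smooth.contMDiffAt (hV.mem_nhds hx)).mdifferentiableAt (by simp)

theorem IsLelieuvreOn.fderiv_chart (he : e ∈ IsManifold.maximalAtlas 𝓘(ℝ, Plane) ∞ M)
    (hf : IsLelieuvreOn c N e.source f) {y : Plane} (hy : y ∈ e.target) (v : Plane) :
    fderiv ℝ (f ∘ e.symm) y v = d f (e.symm y) (chartFrame e y v) :=
  fderiv_comp_symm he hy (hf.mdifferentiableAt e.open_source (e.map_target hy)) v

theorem isNullChart_iff (he : e ∈ IsManifold.maximalAtlas 𝓘(ℝ, Plane) ∞ M) :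
    IsNullChart c e ↔ ∀ y ∈ e.target,
      c.J (e.symm y) (chartFrame e y (1, 0)) = chartFrame e y (1, 0) ∧
      c.J (e.symm y) (chartFrame e y (0, 1)) = -chartFrame e y (0, 1) := by
  refine (and_iff_right he).trans (forall₂_congr fun y hy => ?_)
  rw [← chartFrame_coordEndo he c.J hy, ← chartFrame_coordEndo he c.J hy, ← map_neg,
    (chartFrame_bijective he hy).injective.eq_iff, (chartFrame_bijective he hy).injective.eq_iff]

theorem rescaledChart_mem_maximalAtlas [IsManifold 𝓘(ℝ, Plane) ∞ M]
    (he : e ∈ IsManifold.maximalAtlas 𝓘(ℝ, Plane) ∞ M) (hμ : μ ≠ 0) :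
    rescaledChart e hμ ∈ IsManifold.maximalAtlas 𝓘(ℝ, Plane) ∞ M :=
  OpenPartialHomeomorph.mem_maximalAtlas_of_contMDiffOn _
    ((lieScaleEquiv hμ).symm.contDiff.contMDiff.comp_contMDiffOn
      (contMDiffOn_of_mem_maximalAtlas he))
    ((contMDiffOn_symm_of_mem_maximalAtlas he).comp
      (lieScaleEquiv hμ).contDiff.contMDiff.contMDiffOn fun _ hy => hy)

namespace IsNullChart

variable (he : IsNullChart c e) {y : Plane}
include he

theorem rescaledChart [IsManifold 𝓘(ℝ, Plane) ∞ M] (hμ : μ ≠ 0) :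
    IsNullChart c (KSurf.rescaledChart e hμ) := by
  rw [isNullChart_iff (rescaledChart_mem_maximalAtlas he.1 hμ)]
  intro y (hy : lieScale μ y ∈ e.target)
  have hscale (v : Plane) : mfderiv 𝓘(ℝ, Plane) 𝓘(ℝ, Plane) (lieScale μ) y v = lieScale μ v := by
    rw [mfderiv_eq_fderiv]
    exact DFunLike.congr_fun (lieScaleEquiv hμ).fderiv v
  have hframe (v : Plane) : chartFrame (KSurf.rescaledChart e hμ) y v =
      chartFrame e (lieScale μ y) (lieScale μ v) :=
    (mfderiv_comp_apply y ((mdifferentiable_of_mem_maximalAtlas he.1).mdifferentiableAt_symm hy)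
      (lieScaleEquiv hμ).differentiableAt.mdifferentiableAt v).trans
        (congrArg (chartFrame e (lieScale μ y)) (hscale v))
  obtain ⟨h1, h2⟩ := (isNullChart_iff he.1).mp he (lieScale μ y) hy
  have hfst : chartFrame (KSurf.rescaledChart e hμ) y (1, 0) =
      μ⁻¹ • chartFrame e (lieScale μ y) (1, 0) :=
    (hframe _).trans (by rw [lieScale_fst, map_smul])
  have hsnd : chartFrame (KSurf.rescaledChart e hμ) y (0, 1) =
      μ • chartFrame e (lieScale μ y) (0, 1) :=
    (hframe _).trans (by rw [lieScale_snd, map_smul])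
  change c.J (e.symm (lieScale μ y)) _ = _ ∧ c.J (e.symm (lieScale μ y)) _ = _
  rw [hfst, hsnd, map_smul, map_smul, h1, h2, smul_neg]
  exact ⟨rfl, rfl⟩

theorem fderiv_fst (hf : IsLelieuvreOn c N e.source f) (hN : IsHarmonic c N) (hy : y ∈ e.target) :
    fderiv ℝ (f ∘ e.symm) y (1, 0) = N (e.symm y) ⨯₃ fderiv ℝ (N ∘ e.symm) y (1, 0) := by
  rw [hf.fderiv_chart he.1 hy, hf.eq _ (e.map_target hy), ((isNullChart_iff he.1).mp he y hy).1,
    hN.fderiv_chart he.1 hy]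

theorem fderiv_snd (hf : IsLelieuvreOn c N e.source f) (hN : IsHarmonic c N) (hy : y ∈ e.target) :
    fderiv ℝ (f ∘ e.symm) y (0, 1) = -(N (e.symm y) ⨯₃ fderiv ℝ (N ∘ e.symm) y (0, 1)) := by
  rw [hf.fderiv_chart he.1 hy, hf.eq _ (e.map_target hy), ((isNullChart_iff he.1).mp he y hy).2,
    hN.fderiv_chart he.1 hy, map_neg, map_neg]

theorem cross_mixed_derivative (hN : IsHarmonic c N) (hy : y ∈ e.target) :
    N (e.symm y) ⨯₃ fderiv ℝ (fun z => fderiv ℝ (N ∘ e.symm) z (1, 0)) y (0, 1) = 0 := by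
  have hsnd : e.target.EqOn (fun z => fderiv ℝ (N ∘ e.symm) z (coordEndo c.J e z (0, 1)))
      fun z => -fderiv ℝ (N ∘ e.symm) z (0, 1) := fun z hz => by simp only [(he.2 z hz).2, map_neg]
  have hfst : e.target.EqOn (fun z => fderiv ℝ (N ∘ e.symm) z (coordEndo c.J e z (1, 0)))
      fun z => fderiv ℝ (N ∘ e.symm) z (1, 0) := fun z hz => by simp only [(he.2 z hz).1]
  have hsymm := fderiv_fderiv_apply_comm (((hN.contDiffOn_chart he.1).contDiffAt
    (e.open_target.mem_nhds hy)).of_le ENat.LEInfty.out) (0, 1) (1, 0)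
  have htension := hN.tension e he.1 y hy
  rw [dStarD, fderiv_congr_of_isOpen e.open_target hsnd hy,
    fderiv_congr_of_isOpen e.open_target hfst hy, fderiv_fun_neg, neg_apply, hsymm, ← neg_add',
    map_neg, neg_eq_zero, ← two_smul ℝ, map_smul] at htension
  exact (smul_eq_zero.mp htension).resolve_left two_ne_zero

theorem isSphericalNetOn (hf : IsLelieuvreOn c N e.source f) (hN : IsHarmonic c N)
    {om : Plane → ℝ} (hom : ContDiffOn ℝ ∞ om e.target)
    (hI : HasFirstFormOn e.target (f ∘ e.symm) 1 om 1) :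
    IsSphericalNetOn e.target (N ∘ e.symm) om := by
  have hdot (y : Plane) (hy : y ∈ e.target) (v w : Plane) :
      (N (e.symm y) ⨯₃ fderiv ℝ (N ∘ e.symm) y v) ⬝ᵥ (N (e.symm y) ⨯₃ fderiv ℝ (N ∘ e.symm) y w) =
        fderiv ℝ (N ∘ e.symm) y v ⬝ᵥ fderiv ℝ (N ∘ e.symm) y w :=
    cross_dotProduct_cross_of_dotProduct_eq_zero (hN.unit _)
      ((congrArg _ (hN.fderiv_chart he.1 hy w)).trans (hN.dotProduct_d _ _))
  rw [hasFirstFormOn_iff] at hI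
  have hform (y : Plane) (hy : y ∈ e.target) := hI y hy
  simp +contextual only [he.fderiv_fst hf hN, he.fderiv_snd hf hN, dotProduct_neg, neg_dotProduct,
    neg_neg, hdot, neg_eq_iff_eq_neg] at hform
  exact
    { isOpen := e.open_target
      smooth := hN.contDiffOn_chart he.1
      smooth_angle := hom
      unit := fun _ _ => hN.unit _
      unit_fst := fun y hy => (hform y hy).1
      unit_snd := fun y hy => (hform y hy).2.2
      angle := fun y hy => (hform y hy).2.1
      tension := fun y hy => he.cross_mixed_derivative hN hy }

theorem isTchebyshevOn (hf : IsLelieuvreOn c N e.source f) (hN : IsHarmonic c N) {om : Plane → ℝ}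
    (hI : HasFirstFormOn e.target (f ∘ e.symm) 1 om 1) :
    IsTchebyshevOn e.target (f ∘ e.symm) (N ∘ e.symm) where
  asymp_fst y hy := by
    rw [d_eq_fderiv, d_eq_fderiv, he.fderiv_fst hf hN hy, dot_cross_self]
  asymp_snd y hy := by
    rw [d_eq_fderiv, d_eq_fderiv, he.fderiv_snd hf hN hy, dotProduct_neg, dot_cross_self, neg_zero]
  unit_fst y hy := by
    rw [d_eq_fderiv]
    exact (hasFirstFormOn_iff.mp hI y hy).1
  unit_snd y hy := by
    rw [d_eq_fderiv]
    exact (hasFirstFormOn_iff.mp hI y hy).2.2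

theorem sineGordonOn (hf : IsLelieuvreOn c N e.source f) (hN : IsHarmonic c N)
    (hi : ∀ x ∈ e.source, Function.Injective (d N x)) {om : Plane → ℝ}
    (hom : ContDiffOn ℝ ∞ om e.target) (hI : HasFirstFormOn e.target (f ∘ e.symm) 1 om 1) :
    SineGordonOn e.target (-1) om := by
  refine (he.isSphericalNetOn hf hN hom hI).sineGordonOn fun y hy => ?_
  have h : ⇑(fderiv ℝ (N ∘ e.symm) y) = d N (e.symm y) ∘ chartFrame e y :=
    funext (hN.fderiv_chart he.1 hy)
  rw [h]
  exact (hi _ (e.map_target hy)).comp (chartFrame_bijective he.1 hy).injective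

variable {T : M → Matrix (Fin 3) (Fin 3) ℝ} {fμ : M → R3}

theorem firstForm_transform (hN : IsHarmonic c N)
    (hT : IsTrivialisingGauge c N (μ : ℂ) (fun x => (T x).map Complex.ofReal)) (hμ : μ ≠ 0)
    (hf : IsLelieuvreOn c N e.source f)
    (hfμ : IsLelieuvreOn c (fun x => T x *ᵥ N x) e.source fμ) {om : Plane → ℝ}
    (hI : HasFirstFormOn e.target (f ∘ e.symm) 1 om 1) :
    HasFirstFormOn e.target (fμ ∘ e.symm) (μ ^ 2) om ((μ ^ 2)⁻¹) := by
  rw [hasFirstFormOn_iff] at hI ⊢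
  intro y hy
  have hx := e.map_target hy
  obtain ⟨h1, h2, h3⟩ := hI y hy
  obtain ⟨hJfst, hJsnd⟩ := (isNullChart_iff he.1).mp he y hy
  have hmap (v : Plane) : fderiv ℝ (fμ ∘ e.symm) y v =
      T (e.symm y) *ᵥ d f (e.symm y) (c.boost μ (e.symm y) (chartFrame e y v)) :=
    (hfμ.fderiv_chart he.1 hy v).trans (hT.isLelieuvreOn_d_transform hN hf hfμ hx _)
  rw [hmap, hmap, c.boost_of_J_eq hJfst, c.boost_of_J_eq_neg hJsnd, map_smul, map_smul,
    ← hf.fderiv_chart he.1 hy, ← hf.fderiv_chart he.1 hy]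
  simp only [mulVec_dotProduct_mulVec (hT.real_orth _), smul_dotProduct, dotProduct_smul, h1, h2,
    h3, smul_eq_mul]
  exact ⟨by ring, by rw [inv_mul_cancel_left₀ hμ], by ring⟩

theorem isLieTransform [IsManifold 𝓘(ℝ, Plane) ∞ M] (hN : IsHarmonic c N)
    (hT : IsTrivialisingGauge c N (μ : ℂ) (fun x => (T x).map Complex.ofReal)) (hμ : μ ≠ 0)
    (hf : IsLelieuvreOn c N e.source f)
    (hfμ : IsLelieuvreOn c (fun x => T x *ᵥ N x) e.source fμ) {om : Plane → ℝ}
    (hI : HasFirstFormOn e.target (f ∘ e.symm) 1 om 1)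
    (hi : ∀ x ∈ e.source, Function.Injective (d N x)) (hom : ContDiffOn ℝ ∞ om e.target) :
    IsLieTransform μ e.target (-1) om (fμ ∘ e.symm ∘ lieScale μ)
      ((fun x => T x *ᵥ N x) ∘ e.symm ∘ lieScale μ) := by
  have hNμ := hT.isHarmonic_transform hN
  have hiμ := fun x hx => hT.injective_d_transform hN hμ (hi x hx)
  have hemμ := he.rescaledChart hμ
  have hIμ : HasFirstFormOn (lieScale μ ⁻¹' e.target) (fμ ∘ e.symm ∘ lieScale μ) 1
      (om ∘ lieScale μ) 1 := by
    have h := (he.firstForm_transform hN hT hμ hf hfμ hI).comp_lieScale hμ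
    rwa [inv_pow, inv_mul_cancel₀ (pow_ne_zero 2 hμ), mul_inv_cancel₀ (pow_ne_zero 2 hμ)] at h
  have homμ : ContDiffOn ℝ ∞ (om ∘ lieScale μ) (lieScale μ ⁻¹' e.target) :=
    hom.comp (lieScaleEquiv hμ).contDiff.contDiffOn fun _ hy => hy
  exact
    { ksurface := (hNμ.isKSurfaceOn hfμ hiμ).comp_symm hemμ.1 e.open_source subset_rfl
      tchebyshev := hemμ.isTchebyshevOn hfμ hNμ hIμ
      angle := hIμ
      sineGordon := hemμ.sineGordonOn hfμ hNμ hiμ homμ hIμ }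

end IsNullChart

end LieTransform

/-! ### The Sym formula -/

section CrossVector

variable {R : Type*} [CommRing R]

/-- The vector `a` with `a × u = A u` for all `u`, where `A` is a skew `3 × 3` matrix. -/
def crossVector (A : Matrix (Fin 3) (Fin 3) R) : Fin 3 → R := ![A 2 1, A 0 2, A 1 0]

theorem crossVector_cross [IsAddTorsionFree R] {A : Matrix (Fin 3) (Fin 3) R} (hA : Aᵀ = -A)
    (u : Fin 3 → R) : crossVector A ⨯₃ u = A *ᵥ u := by
  have hskew (i j : Fin 3) : A j i = -A i j := congrFun (congrFun hA i) j
  have hdiag (i : Fin 3) : A i i = 0 := self_eq_neg.mp (hskew i i)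
  ext i
  fin_cases i <;>
    simp [crossVector, cross_apply, Matrix.mulVec, dotProduct, Fin.sum_univ_three, hdiag,
      hskew 0 1, hskew 1 2, hskew 2 0] <;> ring

theorem toC_crossVector (A : Matrix (Fin 3) (Fin 3) ℝ) :
    toC (crossVector A) = crossVector (A.map Complex.ofReal) := by
  ext i
  fin_cases i <;> rfl

theorem toC_crossVector_cross {A : Matrix (Fin 3) (Fin 3) ℝ} (hA : Aᵀ = -A) (u : C3) :
    toC (crossVector A) ⨯₃ u = A.map Complex.ofReal *ᵥ u := by
  rw [toC_crossVector, crossVector_cross]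
  rw [← Matrix.transpose_map, hA]
  ext i j
  simp

end CrossVector

section Curves

variable {n : Type*} [Fintype n] {t : ℝ}

theorem transpose_deriv_mul_transpose [DecidableEq n] {A : ℝ → Matrix n n ℝ} {A' : Matrix n n ℝ}
    (hA : ∀ i j, HasDerivAt (fun s => A s i j) (A' i j) t)
    (horth : ∀ᶠ s in 𝓝 t, A s * (A s)ᵀ = 1) : (A' * (A t)ᵀ)ᵀ = -(A' * (A t)ᵀ) := by
  rw [eq_neg_iff_add_eq_zero, add_comm, Matrix.transpose_mul, Matrix.transpose_transpose]
  ext i k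
  have hprod : HasDerivAt (fun s => (A s * (A s)ᵀ) i k)
      (∑ j, (A' i j * A t k j + A t i j * A' k j)) t :=
    HasDerivAt.fun_sum fun j _ => (hA i j).mul (hA k j)
  have hconst : (fun s => (A s * (A s)ᵀ) i k) =ᶠ[𝓝 t] fun _ => (1 : Matrix n n ℝ) i k :=
    horth.mono fun s hs => congrFun (congrFun hs i) k
  rw [Finset.sum_add_distrib] at hprod
  exact (hprod.congr_of_eventuallyEq hconst.symm).unique (hasDerivAt_const _ _)

end Curves

section GaugeFamily

variable {M : Type*} [TopologicalSpace M] [ChartedSpace Plane M]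
  {c : LorentzConformalStructure M} {N : M → R3} {μ : ℝ} {T : ℝ → M → Matrix (Fin 3) (Fin 3) ℝ}
  {e : OpenPartialHomeomorph M Plane} {y : Plane}

/-- A family of real trivialising gauges of `d_s` for real `s` near `μ`, smooth in all variables. -/
structure IsRealGaugeFamilyNear (c : LorentzConformalStructure M) (N : M → R3) (μ : ℝ)
    (T : ℝ → M → Matrix (Fin 3) (Fin 3) ℝ) : Prop where
  gauge : ∀ᶠ s : ℝ in 𝓝 μ, IsTrivialisingGauge c N (s : ℂ) (fun x => (T s x).map Complex.ofReal)
  smooth : ∀ x i j, ContMDiffAt (𝓘(ℝ, ℝ).prod 𝓘(ℝ, Plane)) 𝓘(ℝ, ℝ) ∞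
    (fun p : ℝ × M => T p.1 p.2 i j) (μ, x)

/-- The derivative `∂T_s/∂s` at `s = μ`. -/
noncomputable def paramDeriv (μ : ℝ) (T : ℝ → M → Matrix (Fin 3) (Fin 3) ℝ) (x : M) :
    Matrix (Fin 3) (Fin 3) ℝ :=
  Matrix.of fun i j => deriv (fun s => T s x i j) μ

/-- The matrix `μ (∂T_s/∂s)|_{s = μ} T_μ⁻¹` for a family of real orthogonal matrices `T_s`, whose
inverses are their transposes. -/
noncomputable def realSymMatrix (μ : ℝ) (T : ℝ → M → Matrix (Fin 3) (Fin 3) ℝ) (x : M) :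
    Matrix (Fin 3) (Fin 3) ℝ :=
  μ • (paramDeriv μ T x * (T μ x)ᵀ)

namespace IsRealGaugeFamilyNear

variable (h : IsRealGaugeFamilyNear c N μ T)
include h

theorem gauge_self : IsTrivialisingGauge c N (μ : ℂ) (fun x => (T μ x).map Complex.ofReal) :=
  h.gauge.self_of_nhds

theorem contDiffAt_comp_symm (he : e ∈ IsManifold.maximalAtlas 𝓘(ℝ, Plane) ∞ M)
    (hy : y ∈ e.target) (i j : Fin 3) :
    ContDiffAt ℝ ∞ (fun p : ℝ × Plane => T p.1 (e.symm p.2) i j) (μ, y) := by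
  have hsymm : ContMDiffAt 𝓘(ℝ, ℝ × Plane) 𝓘(ℝ, Plane) ∞ (fun p : ℝ × Plane => e.symm p.2)
      (μ, y) :=
    ContMDiffAt.comp (μ, y) (contMDiffAt_symm_of_mem_maximalAtlas he hy)
      (contDiff_snd.contMDiff _ : ContMDiffAt 𝓘(ℝ, ℝ × Plane) 𝓘(ℝ, Plane) ∞ Prod.snd (μ, y))
  exact contMDiffAt_iff_contDiffAt.mp
    (ContMDiffAt.comp (μ, y) (h.smooth (e.symm y) i j) (contDiff_fst.contMDiff _ |>.prodMk hsymm))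

theorem contDiffAt_mulVec (he : e ∈ IsManifold.maximalAtlas 𝓘(ℝ, Plane) ∞ M)
    (hy : y ∈ e.target) (u : R3) :
    ContDiffAt ℝ ∞ (fun p : ℝ × Plane => T p.1 (e.symm p.2) *ᵥ u) (μ, y) :=
  contDiffAt_pi.mpr fun i => ContDiffAt.sum (s := Finset.univ) fun j _ =>
    (h.contDiffAt_comp_symm he hy i j).mul contDiffAt_const

theorem contDiffOn_realSymMatrix (he : e ∈ IsManifold.maximalAtlas 𝓘(ℝ, Plane) ∞ M)
    (i k : Fin 3) : ContDiffOn ℝ ∞ (fun z => realSymMatrix μ T (e.symm z) i k) e.target := by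
  have hderiv (j : Fin 3) : ContDiffOn ℝ ∞ (fun z => paramDeriv μ T (e.symm z) i j) e.target :=
    contDiffOn_deriv_prodMk_left fun z hz => h.contDiffAt_comp_symm he hz i j
  exact (contDiffOn_const (c := μ)).mul (ContDiffOn.sum (s := Finset.univ) fun j _ => (hderiv j).mul
    (contDiffOn_comp_symm he (h.gauge_self.real_smooth k j).contMDiffOn (Set.subset_univ _)))

theorem contDiffOn_crossVector (he : e ∈ IsManifold.maximalAtlas 𝓘(ℝ, Plane) ∞ M) :
    ContDiffOn ℝ ∞ ((fun x => crossVector (realSymMatrix μ T x)) ∘ e.symm) e.target := by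
  refine contDiffOn_pi.mpr fun i => ?_
  fin_cases i
  exacts [h.contDiffOn_realSymMatrix he 2 1, h.contDiffOn_realSymMatrix he 0 2,
    h.contDiffOn_realSymMatrix he 1 0]

variable [IsManifold 𝓘(ℝ, Plane) ∞ M]

theorem smooth_crossVector :
    ContMDiff 𝓘(ℝ, Plane) 𝓘(ℝ, R3) ∞ (fun x => crossVector (realSymMatrix μ T x)) := by
  intro x
  obtain ⟨e, he, y, hy, rfl⟩ := exists_mem_maximalAtlas_symm_eq (E := Plane) x
  have hx := e.map_target hy
  have hcomp := (h.contDiffOn_crossVector he).contMDiffOn.comp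
    (contMDiffOn_of_mem_maximalAtlas he) fun p hp => e.map_source hp
  refine (hcomp.contMDiffAt (e.open_source.mem_nhds hx)).congr_of_eventuallyEq ?_
  filter_upwards [e.open_source.mem_nhds hx] with p hp
  simp only [Function.comp_apply, e.left_inv hp]

theorem hasDerivAt_entry (x : M) (i j : Fin 3) :
    HasDerivAt (fun s => T s x i j) (paramDeriv μ T x i j) μ := by
  obtain ⟨e, he, y, hy, rfl⟩ := exists_mem_maximalAtlas_symm_eq (E := Plane) x
  have hT := (h.contDiffAt_comp_symm he hy i j).differentiableAt (by simp)
  exact (hT.comp μ (differentiableAt_id.prodMk (differentiableAt_const y) :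
    DifferentiableAt ℝ (fun s : ℝ => (s, y)) μ)).hasDerivAt

theorem realSymMatrix_transpose (x : M) :
    (realSymMatrix μ T x)ᵀ = -realSymMatrix μ T x := by
  rw [realSymMatrix, Matrix.transpose_smul,
    transpose_deriv_mul_transpose (h.hasDerivAt_entry x)
      (h.gauge.mono fun s hs => hs.real_orth x), smul_neg]

theorem deriv_mulVec_const (x : M) (u : R3) :
    deriv (fun s => T s x *ᵥ u) μ = paramDeriv μ T x *ᵥ u :=
  HasDerivAt.deriv <| hasDerivAt_pi.mpr fun i => HasDerivAt.fun_sum (u := Finset.univ) fun j _ =>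
    (h.hasDerivAt_entry x i j).mul_const (u j)

theorem crossVector_cross_mulVec (x : M) (u : R3) :
    crossVector (realSymMatrix μ T x) ⨯₃ (T μ x *ᵥ u) =
      μ • deriv (fun s => T s x *ᵥ u) μ := by
  rw [crossVector_cross (h.realSymMatrix_transpose x), h.deriv_mulVec_const, realSymMatrix,
    Matrix.smul_mulVec, Matrix.mulVec_mulVec, Matrix.mul_assoc,
    mul_eq_one_comm.mp (h.gauge_self.real_orth x), Matrix.mul_one]

variable (hμ : μ ≠ 0)
include hμ

theorem fderiv_deriv_mulVec (he : e ∈ IsManifold.maximalAtlas 𝓘(ℝ, Plane) ∞ M)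
    (hy : y ∈ e.target) (u : R3) (v : Plane) :
    fderiv ℝ (fun z => deriv (fun s => T s (e.symm z) *ᵥ u) μ) y v =
      deriv (fun s => T s (e.symm y) *ᵥ ((N (e.symm y) ⨯₃ d N (e.symm y)
        (c.boost μ (e.symm y) (chartFrame e y v) - chartFrame e y v)) ⨯₃ u)) μ +
      T μ (e.symm y) *ᵥ ((μ⁻¹ • (N (e.symm y) ⨯₃ d N (e.symm y)
        (c.boost μ (e.symm y) (c.J (e.symm y) (chartFrame e y v))))) ⨯₃ u) := by
  set x := e.symm y
  set X := chartFrame e y v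
  let B : TangentSpace 𝓘(ℝ, Plane) x →L[ℝ] R3 :=
    (crossProduct.flip u ∘ₗ crossProduct (N x)).toContinuousLinearMap.comp (d N x)
  have hB : HasDerivAt (fun s => (N x ⨯₃ d N x (c.boost s x X - X)) ⨯₃ u)
      ((μ⁻¹ • (N x ⨯₃ d N x (c.boost μ x (c.J x X)))) ⨯₃ u) μ := by
    have h1 := (c.hasDerivAt_map_boost B hμ X).sub_const (B X)
    simp only [← map_sub] at h1
    refine h1.congr_deriv ?_
    simp only [map_smul, LinearMap.smul_apply]
    rfl
  have hgauge : (fun s => fderiv ℝ (fun z => T s (e.symm z) *ᵥ u) y v) =ᶠ[𝓝 μ]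
      fun s => T s x *ᵥ ((N x ⨯₃ d N x (c.boost s x X - X)) ⨯₃ u) := by
    filter_upwards [h.gauge] with s hs
    rw [hs.fderiv_mulVec_chart he hy (differentiableAt_const u), fderiv_fun_const, Pi.zero_apply,
      zero_apply, add_zero]
  rw [fderiv_deriv_comm (G := fun p : ℝ × Plane => T p.1 (e.symm p.2) *ᵥ u)
      ((h.contDiffAt_mulVec he hy u).of_le ENat.LEInfty.out), hgauge.deriv_eq,
    deriv_mulVec (fun i j => (h.hasDerivAt_entry x i j).differentiableAt) hB.differentiableAt,
    hB.deriv]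

theorem fderiv_crossVector (he : e ∈ IsManifold.maximalAtlas 𝓘(ℝ, Plane) ∞ M) (hy : y ∈ e.target)
    (v : Plane) :
    fderiv ℝ ((fun x => crossVector (realSymMatrix μ T x)) ∘ e.symm) y v =
      T μ (e.symm y) *ᵥ (N (e.symm y) ⨯₃ d N (e.symm y)
        (c.boost μ (e.symm y) (c.J (e.symm y) (chartFrame e y v)))) := by
  have hT := h.gauge_self
  have horth := hT.real_orth (e.symm y)
  refine crossProduct_injective (LinearMap.ext fun w => ?_)
  obtain ⟨u, rfl⟩ : ∃ u, T μ (e.symm y) *ᵥ u = w :=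
    ⟨(T μ (e.symm y))ᵀ *ᵥ w, by rw [Matrix.mulVec_mulVec, horth, Matrix.one_mulVec]⟩
  have hF := ((h.contDiffOn_crossVector he).contDiffAt
    (e.open_target.mem_nhds hy)).differentiableAt (by simp)
  have hTu : DifferentiableAt ℝ (fun z => T μ (e.symm z) *ᵥ u) y :=
    ((h.contDiffAt_mulVec he hy u).differentiableAt (by simp)).comp y
      ((differentiableAt_const μ).prodMk differentiableAt_id)
  have hderiv : DifferentiableAt ℝ (fun z => deriv (fun s => T s (e.symm z) *ᵥ u) μ) y :=
    ((contDiffOn_deriv_prodMk_left (G := fun p : ℝ × Plane => T p.1 (e.symm p.2) *ᵥ u)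
      fun z hz => h.contDiffAt_mulVec he hz u).contDiffAt
        (e.open_target.mem_nhds hy)).differentiableAt (by simp)
  -- Differentiate `F × T_μ u = μ (∂T_s/∂s) u` along `v`; the terms with `∂T_s/∂s` cancel.
  have hprod := fderiv_cross hF hTu v
  simp only [Function.comp_apply, h.crossVector_cross_mulVec] at hprod
  rw [fderiv_fun_const_smul hderiv, smul_apply, h.fderiv_deriv_mulVec hμ he hy,
    hT.fderiv_mulVec_chart he hy (differentiableAt_const u), fderiv_fun_const, Pi.zero_apply,
    zero_apply, add_zero, h.crossVector_cross_mulVec, smul_add, add_comm, add_left_inj] at hprod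
  rw [mulVec_cross_mulVec horth (hT.real_det _), ← hprod, map_smul, LinearMap.smul_apply,
    Matrix.mulVec_smul, smul_inv_smul₀ hμ]

theorem isLelieuvreOn (hN : IsHarmonic c N) :
    IsLelieuvreOn c (fun x => T μ x *ᵥ N x) Set.univ
      (fun x => crossVector (realSymMatrix μ T x)) where
  smooth := h.smooth_crossVector.contMDiffOn
  eq x _ X := by
    obtain ⟨e, he, y, hy, rfl⟩ := exists_mem_maximalAtlas_symm_eq (E := Plane) x
    obtain ⟨v, rfl⟩ := (chartFrame_bijective he hy).surjective X
    have hT := h.gauge_self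
    have hd := fderiv_comp_symm he hy ((h.smooth_crossVector _).mdifferentiableAt (by simp)) v
    rw [hT.d_transform hN, mulVec_cross_mulVec (hT.real_orth _) (hT.real_det _)]
    exact hd.symm.trans (h.fderiv_crossVector hμ he hy v)

end IsRealGaugeFamilyNear

namespace IsGaugeFamilyNear

variable {𝒯 : ℂ → M → Matrix (Fin 3) (Fin 3) ℂ} (h : IsGaugeFamilyNear c N μ 𝒯)
include h

theorem isRealGaugeFamilyNear :
    IsRealGaugeFamilyNear c N μ (fun s x => (𝒯 (s : ℂ) x).map Complex.re) where
  gauge := by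
    filter_upwards [Complex.continuous_ofReal.continuousAt.eventually h.gauge, h.real] with s hs hr
    convert hs using 2 with x
    ext i j
    exact Complex.ext (by simp) (by simp [hr x i j])
  smooth x i j := by
    have hincl : ContMDiffAt (𝓘(ℝ, ℝ).prod 𝓘(ℝ, Plane)) (𝓘(ℝ, ℂ).prod 𝓘(ℝ, Plane)) ∞
        (fun p : ℝ × M => ((p.1 : ℂ), p.2)) (μ, x) :=
      ((Complex.ofRealCLM.contDiff.contMDiff _).comp (μ, x) contMDiffAt_fst).prodMk contMDiffAt_snd
    exact (Complex.reCLM.contDiff.contMDiff _).comp (μ, x)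
      (ContMDiffAt.comp (μ, x) (h.smooth x i j) hincl)

theorem deriv_eq_ofReal (x : M) (i j : Fin 3) : deriv (fun l => 𝒯 l x i j) (μ : ℂ) =
    (deriv (fun s : ℝ => (𝒯 (s : ℂ) x i j).re) μ : ℝ) := by
  have hcomplex := (h.holo x i j).hasDerivAt
  have him : HasDerivAt (fun s : ℝ => (𝒯 (s : ℂ) x i j).im)
      (deriv (fun l => 𝒯 l x i j) (μ : ℂ)).im μ :=
    Complex.imCLM.hasFDerivAt.comp_hasDerivAt μ hcomplex.comp_ofReal
  have hreal : (fun s : ℝ => (𝒯 (s : ℂ) x i j).im) =ᶠ[𝓝 μ] fun _ => 0 :=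
    h.real.mono fun s hs => hs x i j
  have him_zero := (him.congr_of_eventuallyEq hreal.symm).unique (hasDerivAt_const _ _)
  rw [hcomplex.real_of_complex.deriv]
  exact Complex.ext (by simp) (by simp [him_zero])

theorem symMatrix_eq (x : M) : symMatrix μ 𝒯 x =
    (realSymMatrix μ (fun s x => (𝒯 (s : ℂ) x).map Complex.re) x).map Complex.ofReal := by
  have hre (i j : Fin 3) : ((𝒯 (μ : ℂ) x i j).re : ℂ) = 𝒯 (μ : ℂ) x i j :=
    Complex.ext (by simp) (by simp [h.real.self_of_nhds x i j])
  rw [symMatrix, Matrix.inv_eq_right_inv (h.gauge.self_of_nhds.orth x)]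
  ext i k
  simp [realSymMatrix, paramDeriv, Matrix.mul_apply, h.deriv_eq_ofReal, hre]

end IsGaugeFamilyNear

end GaugeFamily

end KSurf

theorem mainTheorem3 {M : Type*} [TopologicalSpace M] [ChartedSpace KSurf.Plane M]
    [IsManifold 𝓘(ℝ, KSurf.Plane) ∞ M]
    (c : KSurf.LorentzConformalStructure M) (N : M → KSurf.R3) (hN : KSurf.IsHarmonic c N)
    (μ : ℝ) (hμ : μ ≠ 0)
    (T : M → Matrix (Fin 3) (Fin 3) ℝ)
    (hT : KSurf.IsTrivialisingGauge c N (μ : ℂ) (fun x => (T x).map Complex.ofReal))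
    (Nμ : M → KSurf.R3) (hNμ : ∀ x, Nμ x = T x *ᵥ N x) :
    -- `N^μ` is harmonic
    KSurf.IsHarmonic c Nμ ∧
    -- so, locally, there is `f^μ` with `df^μ = N^μ × *dN^μ`
    (∀ x : M, ∃ V : Set M, IsOpen V ∧ x ∈ V ∧
      ∃ fμ : M → KSurf.R3, KSurf.IsLelieuvreOn c Nμ V fμ) ∧
    -- any such `f^μ` is, where `N` immerses, a `K`-surface with Gauss map `N^μ`, `K = -1`
    -- and conformal class of the second fundamental form equal (up to sign) to `c`
    (∀ (V : Set M) (fμ : M → KSurf.R3), IsOpen V → KSurf.IsLelieuvreOn c Nμ V fμ →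
      (∀ x ∈ V, Function.Injective (KSurf.d N x)) →
      KSurf.IsKSurfaceOn V fμ Nμ (-1) ∧
      ∀ x ∈ V, ∃ t : ℝ, t ≠ 0 ∧ ∀ X Y, KSurf.secondForm fμ Nμ x X Y = t * c.g x X Y) ∧
    -- if null coordinates `e = (ξ, η)` are Tchebyshev for the surface `f` of `N`, with angle `ω`:
    -- the first fundamental form of `f^μ`, and `f^μ` as a Lie transform of `f`
    (∀ (V : Set M) (f fμ : M → KSurf.R3) (e : OpenPartialHomeomorph M KSurf.Plane)
      (om : KSurf.Plane → ℝ), IsOpen V →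
      KSurf.IsLelieuvreOn c N V f → KSurf.IsLelieuvreOn c Nμ V fμ →
      KSurf.IsNullChart c e → e.source ⊆ V →
      KSurf.IsTchebyshevOn e.target (f ∘ e.symm) (N ∘ e.symm) →
      KSurf.HasFirstFormOn e.target (f ∘ e.symm) 1 om 1 →
      KSurf.HasFirstFormOn e.target (fμ ∘ e.symm) (μ ^ 2) om ((μ ^ 2)⁻¹) ∧
      ((∀ x ∈ e.source, Function.Injective (KSurf.d N x)) → ContDiffOn ℝ ∞ om e.target →
        KSurf.IsLieTransform μ e.target (-1) om
          (fμ ∘ e.symm ∘ KSurf.lieScale μ) (Nμ ∘ e.symm ∘ KSurf.lieScale μ))) ∧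
    -- the Sym formula
    (∀ 𝒯 : ℂ → M → Matrix (Fin 3) (Fin 3) ℂ, KSurf.IsGaugeFamilyNear c N μ 𝒯 →
      (∀ x, 𝒯 (μ : ℂ) x = (T x).map Complex.ofReal) →
      ∃ F : M → KSurf.R3,
        (∀ x (u : KSurf.C3), KSurf.toC (F x) ⨯₃ u = KSurf.symMatrix μ 𝒯 x *ᵥ u) ∧
        KSurf.IsLelieuvreOn c Nμ Set.univ F ∧
        ∀ (V : Set M) (fμ : M → KSurf.R3), IsOpen V → IsPreconnected V →
          KSurf.IsLelieuvreOn c Nμ V fμ → ∃ v : KSurf.R3, ∀ x ∈ V, fμ x = F x + v) := by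
  obtain rfl : Nμ = fun x => T x *ᵥ N x := funext hNμ
  have hNμ' := hT.isHarmonic_transform hN
  refine ⟨hNμ', hNμ'.exists_lelieuvre, ?_, ?_, ?_⟩
  · intro V fμ _ hf hi
    have hiμ := fun x hx => hT.injective_d_transform hN hμ (hi x hx)
    exact ⟨hNμ'.isKSurfaceOn hf hiμ, fun x hx => hNμ'.secondForm_conformal hf hx (hiμ x hx)⟩
  · intro V f fμ e om _ hf hfμ he heV _ hI
    exact ⟨he.firstForm_transform hN hT hμ (hf.mono heV) (hfμ.mono heV) hI,
      he.isLieTransform hN hT hμ (hf.mono heV) (hfμ.mono heV) hI⟩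
  · intro 𝒯 h𝒯 hμT
    have hreal := h𝒯.isRealGaugeFamilyNear
    have hre : ∀ x, (𝒯 (μ : ℂ) x).map Complex.re = T x := fun x => by
      rw [hμT x]
      ext i j
      exact Complex.ofReal_re _
    have hF := hreal.isLelieuvreOn hμ hN
    simp only [hre] at hF
    refine ⟨_, fun x u => ?_, hF, fun V fμ hV hVc hfμ =>
      hfμ.eq_add_const hV hVc (hF.mono (Set.subset_univ V))⟩
    rw [h𝒯.symMatrix_eq]
    exact KSurf.toC_crossVector_cross (hreal.realSymMatrix_transpose x) u
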